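/- Let $d\in\{2,3\}$ and let $\Omega\subset\mathbb R^d$ be a polygonal/polyhedral domain, i.e. a nonempty open set with $\Omega=\operatorname{int}\overline\Omega$ such that $\overline\Omega$ is the union of the simplices of a finite conforming triangulation. Let $n$ be the outward unit normal on $\partial\Omega$. Let $\Gamma_V,\Gamma_W\subset\partial\Omega$ be disjoint connected sets (possibly empty) with $\overline{\Gamma}_V\cup\overline{\Gamma}_W=\partial\Omega$, whose boundaries relative to $\partial\Omega$ have zero surface measure. Let $\kappa\in\mathbb R$ and put $$V=\{v\in H^1(\Omega): v|_{\Gamma_V}=0\},\qquad W=\{v\in H^1(\Omega): v|_{\Gamma_W}=0\},$$ $$a(v,w)=(\nabla v,\nabla w)+\kappa(v,w),\qquad \mathcal L v=\mathcal L^*v=-\Delta v+\kappa v,$$ where $(\cdot,\cdot)$ is the $L^2(\Omega)$ inner product and restrictions to the boundary are traces. Let $\mathcal T_h$ be a finite conforming triangulation of $\Omega$ into simplices, let $k\ge 0$ be an integer, let $$V_h=W_h=X_h^k:=\{v_h\in H^1(\Omega): v_h|_K\in\mathbb P_k(K)\ \text{ for all } K\in\mathcal T_h\},$$ and define $$a_h(v,w)=(\nabla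 v,\nabla w)+\kappa(v,w)-\langle\nabla w\cdot n,\,v\rangle_{\Gamma_V}-\langle\nabla v\cdot n,\,w\rangle_{\Gamma_W},$$ where $\langle\cdot,\cdot\rangle_\Gamma$ is the $L^2(\Gamma)$ inner product with respect to surface measure, and boundary values of functions and of their gradients are taken as traces from the elements of $\mathcal T_h$; a component of the gradient of a test function that has no such trace is given the boundary value $0$ (its normal derivative is only ever multiplied by a factor that vanishes almost everywhere). Then: 1. (Primal consistency.) Let $f\in L^2(\Omega)$ and let $u\in H^2(\Omega)$ be a solution of the primal Cauchy problem, either in the weak sense, $u\in V$ and $a(u,w)=(f,w)$ for all $w\in W$, or in the strong sense, $-\Delta u+\kappa u=f$ a.e. in $\Omega$ and $\nabla u\cdot n=u=0$ a.e. on $\Gamma_V$. Then $$a_h(u,\varphi)=(\mathcal L u,\varphi)\qquad\text{for all }\varphi\in W+W_h .$$ 2. (Adjoint consistency.) Let $g\in L^2(\Omega)$ and let $z\in H^2(\Omega)$ be a solution of the adjoint Cauchy problem, either in the weak sense, $z\in W$ and $a(v,z)=(g,v)$ for all $v\in V$, or in the strong sense, $-\Delta z+\kappa z=g$ a.e. in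 $\Omega$ and $\nabla z\cdot n=z=0$ a.e. on $\Gamma_W$. Then $$a_h(\phi,z)=(\phi,\mathcal L^* z)\qquad\text{for all }\phi\in V+V_h .$$ -/

import Mathlib

open MeasureTheory Filter Topology Set
open scoped ContDiff

noncomputable section

namespace CauchyFEM

/-- The ambient Euclidean space `ℝ^d`. -/
abbrev Euc (d : ℕ) : Type := EuclideanSpace ℝ (Fin d)

variable {d : ℕ}

/-- The surface measure: the `(d-1)`-dimensional Hausdorff measure, normalised so that it agrees
with Lebesgue measure on hyperplanes. -/
def surf (d : ℕ) : Measure (Euc d) := μHE[d - 1]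

/-- The classical partial derivative `∂_i ψ` of a differentiable function. -/
def partialDeriv (i : Fin d) (ψ : Euc d → ℝ) (x : Euc d) : ℝ :=
  fderiv ℝ ψ x (EuclideanSpace.single i (1 : ℝ))

/-! ### Sobolev spaces on an open set -/

/-- `v ∈ L²(D)`. -/
def MemL2 (D : Set (Euc d)) (v : Euc d → ℝ) : Prop :=
  MemLp v 2 (volume.restrict D)

/-- `g ∈ L²(D)` is the weak partial derivative `∂_i v` on `D`. -/
def IsWeakPartial (D : Set (Euc d)) (i : Fin d) (v g : Euc d → ℝ) : Prop :=
  MemL2 D g ∧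
    ∀ ψ : Euc d → ℝ, ContDiff ℝ ∞ ψ → HasCompactSupport ψ → tsupport ψ ⊆ D →
      ∫ x in D, v x * partialDeriv i ψ x = - ∫ x in D, g x * ψ x

/-- `v ∈ H¹(D)`. -/
def MemH1 (D : Set (Euc d)) (v : Euc d → ℝ) : Prop :=
  MemL2 D v ∧ ∀ i, ∃ g, IsWeakPartial D i v g

open Classical in
/-- The weak partial derivative `∂_i v ∈ L²(D)` (unique almost everywhere on `D`) of a function
that has one; the value is `0` for other functions. -/
def weakPartial (D : Set (Euc d)) (i : Fin d) (v : Euc d → ℝ) : Euc d → ℝ :=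
  if h : ∃ g, IsWeakPartial D i v g then h.choose else 0

/-- `v ∈ H²(D)`. -/
def MemH2 (D : Set (Euc d)) (v : Euc d → ℝ) : Prop :=
  MemH1 D v ∧ ∀ i, MemH1 D (weakPartial D i v)

/-- The weak Laplacian of a function of `H²(D)`. -/
def laplacian (D : Set (Euc d)) (v : Euc d → ℝ) (x : Euc d) : ℝ :=
  ∑ i, weakPartial D i (weakPartial D i v) x

/-- The inner product of `L²(D)`. -/
def innerL2 (D : Set (Euc d)) (v w : Euc d → ℝ) : ℝ :=
  ∫ x in D, v x * w x

/-- `(∇v, ∇w)_D`. -/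
def innerGrad (D : Set (Euc d)) (v w : Euc d → ℝ) : ℝ :=
  ∫ x in D, ∑ i, weakPartial D i v x * weakPartial D i w x

/-- `g ∈ L²(S)` is the trace on `S ⊆ ∂D` of `v ∈ H¹(D)`: some sequence of restrictions of smooth
functions converges to `v` in `H¹(D)` while its restrictions to `S` converge to `g` in `L²(S)`. -/
def HasTrace (D S : Set (Euc d)) (v g : Euc d → ℝ) : Prop :=
  MemH1 D v ∧ MemLp g 2 ((surf d).restrict S) ∧
    ∃ ψ : ℕ → Euc d → ℝ, (∀ n, ContDiff ℝ ∞ (ψ n)) ∧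
      Tendsto (fun n => eLpNorm (fun x => ψ n x - v x) 2 (volume.restrict D)) atTop (𝓝 0) ∧
      (∀ i, Tendsto (fun n => eLpNorm (fun x => partialDeriv i (ψ n) x - weakPartial D i v x) 2
        (volume.restrict D)) atTop (𝓝 0)) ∧
      Tendsto (fun n => eLpNorm (fun x => ψ n x - g x) 2 ((surf d).restrict S)) atTop (𝓝 0)

/-- The space `{v ∈ H¹(Ω) : v = 0 on Γ}` for `Γ ⊆ ∂Ω`, in the sense of traces. -/
def MemH1Zero (Ω Γ : Set (Euc d)) (v : Euc d → ℝ) : Prop :=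
  MemH1 Ω v ∧ ∃ g, HasTrace Ω (frontier Ω) v g ∧ ∀ᵐ x ∂((surf d).restrict Γ), g x = 0

/-! ### Polygonal / polyhedral domains, triangulations, finite elements -/

/-- A (conforming, finite) triangulation of the domain `Ω`. -/
structure Triangulation (Ω : Set (Euc d)) where
  /-- The underlying simplicial complex. -/
  complex : Geometry.SimplicialComplex ℝ (Euc d)
  finite : complex.faces.Finite
  /-- Every face belongs to a `d`-dimensional simplex. -/
  pure : ∀ s ∈ complex.faces, ∃ t ∈ complex.faces, s ⊆ t ∧ t.card = d + 1
  space_eq : complex.space = closure Ω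

/-- The elements of the triangulation, given by their vertex sets. -/
def Triangulation.elements {Ω : Set (Euc d)} (T : Triangulation Ω) : Set (Finset (Euc d)) :=
  {s | s ∈ T.complex.faces ∧ s.card = d + 1}

/-- A polygonal / polyhedral domain: a nonempty open set which is the interior of its closure and
whose closure is the union of the simplices of a finite triangulation. -/
def IsPolyhedralDomain (Ω : Set (Euc d)) : Prop :=
  Ω.Nonempty ∧ IsOpen Ω ∧ interior (closure Ω) = Ω ∧ Nonempty (Triangulation Ω)

/-- The finite element space `X_h^k = {v ∈ H¹(Ω) : v|_K ∈ ℙ_k(K) for all elements K}`. -/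
def MemFE {Ω : Set (Euc d)} (T : Triangulation Ω) (k : ℕ) (v : Euc d → ℝ) : Prop :=
  MemH1 Ω v ∧ ∀ s ∈ T.elements, ∃ p : MvPolynomial (Fin d) ℝ, p.totalDegree ≤ k ∧
    ∀ᵐ x ∂(volume.restrict (convexHull ℝ (s : Set (Euc d)))),
      v x = MvPolynomial.eval (fun j => x j) p

/-- `ν` is the outward unit normal to `Ω` at a boundary point `x` near which `Ω` is a half-space. -/
def IsOuterNormal (Ω : Set (Euc d)) (x ν : Euc d) : Prop :=
  ‖ν‖ = 1 ∧ ∃ ε > 0, ∀ y ∈ Metric.ball x ε, y ∈ Ω ↔ inner ℝ (y - x) ν < 0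

open Classical in
/-- The outward unit normal `n` on the flat parts of `∂Ω` (hence almost everywhere on the boundary
of a polyhedral domain), and `0` elsewhere. -/
def outerNormal (Ω : Set (Euc d)) (x : Euc d) : Euc d :=
  if h : ∃ ν, IsOuterNormal Ω x ν then h.choose else 0

/-- `g` is the elementwise trace on `∂Ω` of the piecewise `H¹` function `v`: on each face on `∂Ω`
of each element `K` (the face opposite to a vertex `p` of `K`), `g` is the trace of `v|_K`. -/
def IsBdryTrace {Ω : Set (Euc d)} (T : Triangulation Ω) (v g : Euc d → ℝ) : Prop :=
  ∀ s ∈ T.elements, ∀ p ∈ s,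
    convexHull ℝ ((s : Set (Euc d)) \ {p}) ⊆ frontier Ω →
      HasTrace (interior (convexHull ℝ (s : Set (Euc d))))
        (convexHull ℝ ((s : Set (Euc d)) \ {p})) v g

open Classical in
/-- The elementwise trace on `∂Ω` of a function that has one, and `0` for other functions. It exists
for every function that is `H¹` on each element, and is unique almost everywhere on `∂Ω`. -/
def bdryTrace {Ω : Set (Euc d)} (T : Triangulation Ω) (v : Euc d → ℝ) : Euc d → ℝ :=
  if h : ∃ g, IsBdryTrace T v g then h.choose else 0

/-- The normal derivative `∇v · n` on `∂Ω`, for `v ∈ H¹(Ω)` whose gradient is piecewise `H¹`. -/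
def normalDeriv {Ω : Set (Euc d)} (T : Triangulation Ω) (v : Euc d → ℝ) (x : Euc d) : ℝ :=
  ∑ i, bdryTrace T (weakPartial Ω i v) x * outerNormal Ω x i

/-! ### The Cauchy problem and its discrete bilinear form -/

/-- The splitting of `∂Ω` into two disjoint connected portions whose closures cover `∂Ω` and whose
boundaries relative to `∂Ω` are null sets of the surface measure. -/
structure IsBoundarySplitting (Ω ΓV ΓW : Set (Euc d)) : Prop where
  subset_V : ΓV ⊆ frontier Ω
  subset_W : ΓW ⊆ frontier Ω
  connected_V : IsPreconnected ΓV
  connected_W : IsPreconnected ΓW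
  disjoint : Disjoint ΓV ΓW
  cover : closure ΓV ∪ closure ΓW = frontier Ω
  null_V : surf d (closure ΓV ∩ closure (frontier Ω \ ΓV)) = 0
  null_W : surf d (closure ΓW ∩ closure (frontier Ω \ ΓW)) = 0

/-- The operator `ℒ v = -Δ v + κ v`. -/
def opL (Ω : Set (Euc d)) (κ : ℝ) (v : Euc d → ℝ) (x : Euc d) : ℝ :=
  - laplacian Ω v x + κ * v x

/-- The formal adjoint `ℒ* z = -Δ z + κ z`, given by the same expression. -/
def opLAdj (Ω : Set (Euc d)) (κ : ℝ) (z : Euc d → ℝ) (x : Euc d) : ℝ :=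
  - laplacian Ω z x + κ * z x

/-- `a(v,w) = (∇v,∇w) + κ (v,w)`. -/
def formA (Ω : Set (Euc d)) (κ : ℝ) (v w : Euc d → ℝ) : ℝ :=
  innerGrad Ω v w + κ * innerL2 Ω v w

/-- Weak solutions of the primal problem: `u ∈ V` and `a(u,w) = (f,w)` for all `w ∈ W`. -/
def IsWeakPrimal (Ω ΓV ΓW : Set (Euc d)) (κ : ℝ) (f u : Euc d → ℝ) : Prop :=
  MemH1Zero Ω ΓV u ∧ ∀ w, MemH1Zero Ω ΓW w → formA Ω κ u w = innerL2 Ω f w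

/-- Weak solutions of the adjoint problem: `z ∈ W` and `a(v,z) = (g,v)` for all `v ∈ V`. -/
def IsWeakAdjoint (Ω ΓV ΓW : Set (Euc d)) (κ : ℝ) (g z : Euc d → ℝ) : Prop :=
  MemH1Zero Ω ΓW z ∧ ∀ v, MemH1Zero Ω ΓV v → formA Ω κ v z = innerL2 Ω g v

/-- Strong solutions (among functions of `H²(Ω)`) of the primal problem: `-Δu + κu = f` in `Ω`,
`∇u·n = u = 0` on `Γ_V`. -/
def IsStrongPrimal {Ω : Set (Euc d)} (T : Triangulation Ω) (ΓV : Set (Euc d)) (κ : ℝ)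
    (f u : Euc d → ℝ) : Prop :=
  MemH1Zero Ω ΓV u ∧ (∀ᵐ x ∂(volume.restrict Ω), opL Ω κ u x = f x) ∧
    ∀ᵐ x ∂((surf d).restrict ΓV), normalDeriv T u x = 0

/-- Strong solutions (among functions of `H²(Ω)`) of the adjoint problem: `-Δz + κz = g` in `Ω`,
`∇z·n = z = 0` on `Γ_W`. -/
def IsStrongAdjoint {Ω : Set (Euc d)} (T : Triangulation Ω) (ΓW : Set (Euc d)) (κ : ℝ)
    (g z : Euc d → ℝ) : Prop :=
  MemH1Zero Ω ΓW z ∧ (∀ᵐ x ∂(volume.restrict Ω), opLAdj Ω κ z x = g x) ∧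
    ∀ᵐ x ∂((surf d).restrict ΓW), normalDeriv T z x = 0

/-- The bilinear form
`a_h(v,w) = (∇v,∇w) + κ (v,w) - ⟨∇w·n, v⟩_{Γ_V} - ⟨∇v·n, w⟩_{Γ_W}`. -/
def formAh {Ω : Set (Euc d)} (T : Triangulation Ω) (ΓV ΓW : Set (Euc d)) (κ : ℝ)
    (v w : Euc d → ℝ) : ℝ :=
  innerGrad Ω v w + κ * innerL2 Ω v w
    - (∫ x in ΓV, normalDeriv T w x * bdryTrace T v x ∂(surf d))
    - ∫ x in ΓW, normalDeriv T v x * bdryTrace T w x ∂(surf d)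

end CauchyFEM

end

/-! Consistency is Green's formula. For `u ∈ H²(Ω)` and `w ∈ H¹(Ω)` it gives `(∇u,∇w) + κ(u,w) =
(ℒu,w) + ⟨∇u·n, w⟩_{∂Ω}`. If the Cauchy data of `u` vanish on `Γ_V`, the boundary term lives on
`Γ_W` only and is the one subtracted in `a_h`, while the other boundary term of `a_h` contains the
factor `u|_{Γ_V} = 0` (`formAh_eq`). Only `w ∈ H¹(Ω)` is used, so `W + W_h` needs no separate
treatment. The adjoint statement is the primal one with the two boundary parts exchanged, since the
form is symmetric under this exchange (`formAh_comm`).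

A weak solution has zero normal derivative on `Γ_V` by a variational argument: test functions
supported in `Ω` give `ℒu = f`, and then smooth functions supported away from `closure Γ_W` give
`∇u·n = 0` on `Γ_V` (`IsWeakPrimal.normalDeriv_eq_zero`).

Green's formula is built from single simplices. Polar coordinates centred at a vertex yield the
divergence theorem for radial fields, whose combinations give constant fields
(`integral_simplexBody_fderiv`); the same radial identity gives the trace inequality. With density
of smooth functions on convex sets (`exists_tendstoH1`) this produces traces and integration by
parts on each element.

Summing over elements leaves fluxes on all facets. Conformity shows that almost every facet point in
`Ω` lies on exactly two facets with opposite normals, and almost every boundary point on exactly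
one, whose normal is the outer normal. The definition of the weak derivative forces the jumps inside
`Ω` to vanish (`jump_ae_eq_zero`), so the interior fluxes cancel and only `∂Ω` remains
(`integral_by_parts`). -/

noncomputable section

namespace CauchyFEM

variable {d : ℕ}

set_option linter.unusedSectionVars false

/-! ### Simplices in barycentric coordinates -/

section Simplex

variable {ι : Type*} [Fintype ι] (b : AffineBasis ι ℝ (Euc d))

/-- The closed simplex spanned by an affine basis. -/
def simplexBody : Set (Euc d) := {x | ∀ j, 0 ≤ b.coord j x}

/-- The closed face of a simplex opposite to a vertex. -/
def simplexFace (i : ι) : Set (Euc d) := {x | x ∈ simplexBody b ∧ b.coord i x = 0}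

/-- The gradient of a barycentric coordinate. -/
def coordGrad (i : ι) : Euc d :=
  (InnerProductSpace.toDual ℝ (Euc d)).symm (LinearMap.toContinuousLinearMap (b.coord i).linear)

/-- The vector from a vertex to its orthogonal projection on the opposite face. -/
def altitude (i : ι) : Euc d := -((‖coordGrad b i‖ ^ 2)⁻¹ • coordGrad b i)

lemma inner_coordGrad (i : ι) (y : Euc d) :
    inner ℝ (coordGrad b i) y = (b.coord i).linear y := by
  simp [coordGrad]

lemma coord_add (i : ι) (x y : Euc d) :
    b.coord i (x + y) = b.coord i x + inner ℝ (coordGrad b i) y := by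
  rw [inner_coordGrad, add_comm x y, ← vadd_eq_add, AffineMap.map_vadd, vadd_eq_add, add_comm]

lemma coord_eq_add (i : ι) (x y : Euc d) :
    b.coord i y = b.coord i x + inner ℝ (coordGrad b i) (y - x) := by
  rw [← coord_add, add_sub_cancel]

lemma continuous_coord (i : ι) : Continuous (b.coord i) :=
  (b.coord i).continuous_of_finiteDimensional

lemma coordGrad_ne_zero [Nontrivial ι] (i : ι) : coordGrad b i ≠ 0 := by
  intro h
  obtain ⟨j, hj⟩ := exists_ne i
  have := coord_eq_add b i (b j) (b i)
  simp [h, AffineBasis.coord_apply_ne, hj.symm] at this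

lemma altitude_ne_zero [Nontrivial ι] (i : ι) : altitude b i ≠ 0 := by
  have := coordGrad_ne_zero b i
  simp [altitude, this]

lemma norm_altitude (i : ι) : ‖altitude b i‖ = ‖coordGrad b i‖⁻¹ := by
  by_cases h : ‖coordGrad b i‖ = 0
  · simp [altitude, h]
  · simp only [altitude, norm_neg, norm_smul, norm_inv, norm_pow, norm_norm]
    field_simp

lemma isClosed_simplexBody : IsClosed (simplexBody b) := by
  simp only [simplexBody, ofPred_forall]
  exact isClosed_iInter fun j => isClosed_le continuous_const (continuous_coord b j)

lemma isClosed_simplexFace (i : ι) : IsClosed (simplexFace b i) :=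
  (isClosed_simplexBody b).inter (isClosed_eq (continuous_coord b i) continuous_const)

lemma simplexBody_eq_convexHull : simplexBody b = convexHull ℝ (range b) :=
  b.convexHull_eq_nonneg_coord.symm

lemma interior_simplexBody : interior (simplexBody b) = {x | ∀ j, 0 < b.coord j x} := by
  rw [simplexBody_eq_convexHull, b.interior_convexHull]

lemma isCompact_simplexBody : IsCompact (simplexBody b) := by
  rw [simplexBody_eq_convexHull]
  exact (finite_range b).isCompact_convexHull ℝ

lemma isCompact_simplexFace (i : ι) : IsCompact (simplexFace b i) :=
  (isCompact_simplexBody b).of_isClosed_subset (isClosed_simplexFace b i) fun _ h => h.1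

lemma coord_le_one {x : Euc d} (hx : x ∈ simplexBody b) (i : ι) : b.coord i x ≤ 1 := by
  rw [← b.sum_coord_apply_eq_one x]
  exact Finset.single_le_sum (fun j _ => hx j) (Finset.mem_univ i)

/-- The altitude is antiparallel to `coordGrad b i` and has the reciprocal length, so a displacement
by `τ • altitude b i` lowers the coordinate by exactly `τ`. -/
lemma mem_hyperplane_iff [Nontrivial ι] (i : ι) (τ : ℝ) (x : Euc d) :
    x ∈ AffineSubspace.mk' (τ • altitude b i +ᵥ b i) (Submodule.span ℝ {altitude b i})ᗮ ↔
      b.coord i x = 1 - τ := by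
  have hg := coordGrad_ne_zero b i
  have hg' : ‖coordGrad b i‖ ≠ 0 := by simpa using hg
  rw [AffineSubspace.mem_mk', Submodule.mem_orthogonal_singleton_iff_inner_right,
    coord_eq_add b i (b i) x, b.coord_apply_eq]
  have : x -ᵥ (τ • altitude b i +ᵥ b i) = (x - b i) - τ • altitude b i := by
    simp only [vsub_eq_sub, vadd_eq_add]; abel
  rw [this, inner_sub_right, inner_smul_right, real_inner_self_eq_norm_sq, norm_altitude]
  simp only [altitude, inner_neg_left, inner_smul_left]
  simp only [RCLike.conj_to_real]
  constructor
  · intro h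
    field_simp at h
    linarith
  · intro h
    have : inner ℝ (coordGrad b i) (x - b i) = - τ := by linarith
    rw [this]; field_simp; ring

lemma coord_homothety (i j : ι) (τ : ℝ) (z : Euc d) :
    b.coord j (AffineMap.homothety (b i) τ z) =
      (1 - τ) * b.coord j (b i) + τ * b.coord j z := by
  rw [AffineMap.homothety_eq_lineMap, AffineMap.apply_lineMap, AffineMap.lineMap_apply_ring]

/-- The slices of a simplex parallel to a face are homothetic to it. -/
lemma slice_eq_image [Nontrivial ι] (i : ι) {τ : ℝ} (h0 : 0 < τ) (h1 : τ ≤ 1) (A : Set (Euc d)) :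
    (simplexBody b ∩ A) ∩
        AffineSubspace.mk' (τ • altitude b i +ᵥ b i) (Submodule.span ℝ {altitude b i})ᗮ =
      AffineMap.homothety (b i) τ ''
        (simplexFace b i ∩ AffineMap.homothety (b i) τ ⁻¹' A) := by
  ext x
  simp only [mem_inter_iff, SetLike.mem_coe, mem_hyperplane_iff, mem_image, mem_preimage]
  constructor
  · rintro ⟨⟨hx, hA⟩, hi⟩
    have hinv : AffineMap.homothety (b i) τ (AffineMap.homothety (b i) τ⁻¹ x) = x := by
      rw [← AffineMap.homothety_mul_apply, mul_inv_cancel₀ h0.ne', AffineMap.homothety_one]; rfl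
    have hci : b.coord i (AffineMap.homothety (b i) τ⁻¹ x) = 0 := by
      rw [coord_homothety, b.coord_apply_eq, hi]; field_simp; ring
    refine ⟨AffineMap.homothety (b i) τ⁻¹ x, ⟨⟨fun j => ?_, hci⟩, by rwa [hinv]⟩, hinv⟩
    by_cases hj : j = i
    · rw [hj, hci]
    · rw [coord_homothety, b.coord_apply_ne hj, mul_zero, zero_add]
      exact mul_nonneg (inv_nonneg.2 h0.le) (hx j)
  · rintro ⟨z, ⟨⟨hz, hzi⟩, hA⟩, rfl⟩
    refine ⟨⟨fun j => ?_, hA⟩, ?_⟩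
    · rw [coord_homothety]
      have : 0 ≤ b.coord j (b i) := by
        by_cases hj : j = i
        · rw [hj, b.coord_apply_eq]; exact zero_le_one
        · rw [b.coord_apply_ne hj]
      exact add_nonneg (mul_nonneg (by linarith) this) (mul_nonneg h0.le (hz j))
    · rw [coord_homothety, b.coord_apply_eq, hzi]; ring

/-- Cavalieri's principle along the altitude: the slice at height `τ` is the opposite face scaled by
`τ` about the vertex, which multiplies `(d-1)`-dimensional measure by `τ ^ (d - 1)`. -/
lemma volume_simplexBody_inter [Nontrivial ι] (i : ι) {A : Set (Euc d)} (hA : MeasurableSet A) :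
    volume (simplexBody b ∩ A) = ‖altitude b i‖ₑ * ∫⁻ τ in Ioo (0 : ℝ) 1,
      ENNReal.ofReal (τ ^ (d - 1)) *
        surf d (simplexFace b i ∩ AffineMap.homothety (b i) τ ⁻¹' A) := by
  have hf : Module.finrank ℝ (Euc d) = d := by simp
  have key := EuclideanGeometry.euclideanHausdorffMeasure_eq_lintegral (V := Euc d) (b i)
    (altitude_ne_zero b i) ((isClosed_simplexBody b).measurableSet.inter hA)
  rw [InnerProductSpace.euclideanHausdorffMeasure_eq_volume, hf] at key
  rw [key, ← lintegral_indicator measurableSet_Ioo]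
  congr 1
  have h01 : ∀ᵐ τ : ℝ, τ ≠ 0 ∧ τ ≠ 1 := by
    rw [ae_iff]
    refine measure_mono_null (t := {0, 1}) ?_ (by
      exact (Set.toFinite _).measure_zero _)
    intro τ; simp only [mem_ofPred_eq, mem_insert_iff, mem_singleton_iff]; tauto
  refine lintegral_congr_ae ?_
  filter_upwards [h01] with τ hτ
  by_cases hmem : τ ∈ Ioo (0 : ℝ) 1
  · rw [indicator_of_mem hmem, slice_eq_image b i hmem.1 hmem.2.le,
      euclideanHausdorffMeasure_homothety_image _ _ hmem.1.ne', surf]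
    rw [ENNReal.smul_def, smul_eq_mul]
    congr 1
    rw [ENNReal.coe_pow, ENNReal.ofReal_pow hmem.1.le, ← enorm_eq_nnnorm,
      Real.enorm_eq_ofReal hmem.1.le]
  -- On the simplex the coordinate `1 - τ` lies in `[0, 1]`, so all other slices are empty; the two
  -- end values of `τ` form a null set.
  · rw [indicator_of_notMem hmem]
    convert measure_empty (μ := (μHE[d - 1] : Measure (Euc d)))
    rw [eq_empty_iff_forall_notMem]
    rintro x ⟨⟨hx, -⟩, hx'⟩
    rw [SetLike.mem_coe, mem_hyperplane_iff] at hx'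
    have h1 := coord_le_one b hx i
    have h0 := hx i
    exact hmem ⟨lt_of_le_of_ne (by linarith) hτ.1.symm, lt_of_le_of_ne (by linarith) hτ.2⟩

end Simplex

/-! ### Polar coordinates at a vertex and the divergence theorem on a simplex -/

section Simplex

variable {ι : Type*} [Fintype ι] (b : AffineBasis ι ℝ (Euc d))

lemma lintegral_pow_ne_zero (n : ℕ) :
    ∫⁻ τ in Ioo (0 : ℝ) 1, ENNReal.ofReal (τ ^ n) ≠ 0 := by
  intro h
  rw [lintegral_eq_zero_iff (by fun_prop), Filter.EventuallyEq,
    ae_restrict_iff' measurableSet_Ioo] at h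
  have h2 : volume (Ioo (0 : ℝ) 1) = 0 := by
    refine measure_mono_null (fun τ hτ => ?_) (ae_iff.1 h)
    simp only [mem_ofPred_eq, Classical.not_imp, Pi.zero_apply, ENNReal.ofReal_eq_zero, not_le]
    exact ⟨hτ, pow_pos hτ.1 n⟩
  simp at h2

/-- A face of infinite measure would span a cone, the simplex itself, of infinite volume. -/
lemma surf_simplexFace_lt_top [Nontrivial ι] (i : ι) : surf d (simplexFace b i) < ⊤ := by
  rw [lt_top_iff_ne_top]
  intro h
  have key := volume_simplexBody_inter b i MeasurableSet.univ
  simp only [inter_univ, preimage_univ, h] at key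
  rw [lintegral_mul_const _ (by fun_prop),
    ENNReal.mul_top (lintegral_pow_ne_zero _), ENNReal.mul_top (by simp [altitude_ne_zero])] at key
  exact (isCompact_simplexBody b).measure_lt_top.ne key

/-- The cone from `b i` over the intersection stays in the face opposite to `b j`, which lies in a
hyperplane and has volume zero. A base of positive surface measure would give this cone positive
volume. -/
lemma surf_simplexFace_inter_eq_zero [Nontrivial ι] {i j : ι} (hij : i ≠ j) :
    surf d (simplexFace b i ∩ simplexFace b j) = 0 := by
  have key := volume_simplexBody_inter b i (isClosed_simplexFace b j).measurableSet
  have h0 : volume (simplexBody b ∩ simplexFace b j) = 0 := by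
    let S : AffineSubspace ℝ (Euc d) := (AffineSubspace.mk' (0 : ℝ) ⊥).comap (b.coord j)
    have hS : S ≠ ⊤ := by
      intro h
      have : b j ∈ S := by rw [h]; trivial
      simp [S, AffineSubspace.mem_mk'] at this
    refine measure_mono_null (fun x hx => ?_) (Measure.addHaar_affineSubspace volume S hS)
    simpa [S, AffineSubspace.mem_mk'] using hx.2.2
  rw [h0] at key
  by_contra hne
  have h2 : (∫⁻ τ in Ioo (0 : ℝ) 1, ENNReal.ofReal (τ ^ (d - 1))) *
      surf d (simplexFace b i ∩ simplexFace b j) ≤ ∫⁻ τ in Ioo (0 : ℝ) 1,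
      ENNReal.ofReal (τ ^ (d - 1)) * surf d (simplexFace b i ∩
        AffineMap.homothety (b i) τ ⁻¹' simplexFace b j) := by
    rw [← lintegral_mul_const _ (by fun_prop)]
    refine setLIntegral_mono_ae' measurableSet_Ioo (Eventually.of_forall fun τ hτ => ?_)
    refine mul_le_mul_right (measure_mono fun x hx => And.intro hx.1 (And.intro (fun k => ?_) ?_)) _
    · rw [coord_homothety]
      have : 0 ≤ b.coord k (b i) := by
        by_cases hj : k = i
        · rw [hj, b.coord_apply_eq]; exact zero_le_one
        · rw [b.coord_apply_ne hj]
      exact add_nonneg (mul_nonneg (by linarith [hτ.2]) this) (mul_nonneg hτ.1.le (hx.1.1 k))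
    · rw [coord_homothety, b.coord_apply_ne hij.symm, hx.2.2]; ring
  have h3 := (mul_eq_zero.1 key.symm).resolve_left (by simp [altitude_ne_zero])
  rw [h3, nonpos_iff_eq_zero] at h2
  exact (mul_ne_zero (lintegral_pow_ne_zero _) hne) h2

/-- The measure `τ ^ (d - 1) dτ` on `(0, 1)`. -/
def coneMeasure (d : ℕ) : Measure ℝ :=
  (volume.restrict (Ioo (0 : ℝ) 1)).withDensity fun τ => ENNReal.ofReal (τ ^ (d - 1))

instance isFiniteMeasure_coneMeasure : IsFiniteMeasure (coneMeasure d) := by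
  refine isFiniteMeasure_withDensity (ne_of_lt ?_)
  calc ∫⁻ τ in Ioo (0 : ℝ) 1, ENNReal.ofReal (τ ^ (d - 1))
      ≤ ∫⁻ τ in Ioo (0 : ℝ) 1, 1 := by
        refine setLIntegral_mono_ae' measurableSet_Ioo (Eventually.of_forall fun τ hτ => ?_)
        exact ENNReal.ofReal_le_one.2 (pow_le_one₀ hτ.1.le hτ.2.le)
    _ < ⊤ := by simp

instance isFiniteMeasure_surf_simplexFace [Nontrivial ι] (i : ι) :
    IsFiniteMeasure ((surf d).restrict (simplexFace b i)) :=
  ⟨by simpa using surf_simplexFace_lt_top b i⟩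

lemma continuous_cone (p : Euc d) :
    Continuous fun z : ℝ × Euc d => AffineMap.homothety p z.1 z.2 := by
  simp only [AffineMap.homothety_apply, vsub_eq_sub, vadd_eq_add]
  fun_prop

/-- Integration over a simplex in polar coordinates centred at a vertex. -/
lemma volume_restrict_simplexBody [Nontrivial ι] (i : ι) :
    volume.restrict (simplexBody b) = ‖altitude b i‖ₑ •
      ((coneMeasure d).prod ((surf d).restrict (simplexFace b i))).map
        fun z => AffineMap.homothety (b i) z.1 z.2 := by
  ext A hA
  have hm : Measurable fun z : ℝ × Euc d => AffineMap.homothety (b i) z.1 z.2 :=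
    (continuous_cone (b i)).measurable
  rw [Measure.restrict_apply hA, inter_comm, volume_simplexBody_inter b i hA,
    Measure.smul_apply, Measure.map_apply hm hA, Measure.prod_apply (hm hA), coneMeasure,
    lintegral_withDensity_eq_lintegral_mul _ (by fun_prop) (measurable_measure_prodMk_left (hm hA)),
    smul_eq_mul]
  congr 1
  refine lintegral_congr fun τ => ?_
  rw [Pi.mul_apply, Measure.restrict_apply (measurable_prodMk_left (hm hA)), inter_comm]
  rfl

/-- The divergence theorem on a simplex for the field `ψ(x) (x - p)`, where `p` is a vertex. -/
lemma integral_simplexBody_cone (hd : d ≠ 0) [Nontrivial ι] (i : ι) {ψ : Euc d → ℝ}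
    (hψ : ContDiff ℝ 1 ψ) :
    ∫ x in simplexBody b, (d * ψ x + fderiv ℝ ψ x (x - b i)) =
      ‖altitude b i‖ * ∫ x in simplexFace b i, ψ x ∂(surf d) := by
  have hcont : Continuous fun x => (d * ψ x + fderiv ℝ ψ x (x - b i)) := by
    have := hψ.continuous_fderiv one_ne_zero
    have := hψ.continuous
    fun_prop
  have hm := continuous_cone (b i)
  have hint := hcont.continuousOn.integrableOn_compact (μ := volume) (isCompact_simplexBody b)
  rw [IntegrableOn, volume_restrict_simplexBody b i, integrable_smul_measure
    (by simp [altitude_ne_zero]) (by simp), integrable_map_measure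
    hcont.aestronglyMeasurable hm.aemeasurable] at hint
  rw [volume_restrict_simplexBody b i, integral_smul_measure,
    integral_map hm.aemeasurable hcont.aestronglyMeasurable]
  simp only [toReal_enorm, smul_eq_mul]
  congr 1
  refine (integral_prod_symm _ hint).trans ?_
  refine integral_congr_ae (Eventually.of_forall fun z => ?_)
  simp only [coneMeasure, Function.comp_apply]
  rw [integral_withDensity_eq_integral_toReal_smul (by fun_prop) (by simp),
    ← integral_Ioc_eq_integral_Ioo, ← intervalIntegral.integral_of_le zero_le_one]
  -- With the weight `τ ^ (d - 1)`, the integrand is the derivative of `τ ^ d * ψ` along the ray.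
  -- The end `τ = 1` gives the face value, and the end `τ = 0` contributes nothing because `d ≠ 0`.
  have hderiv : ∀ τ ∈ uIcc (0 : ℝ) 1, HasDerivAt
      (fun τ : ℝ => τ ^ d * ψ (AffineMap.homothety (b i) τ z))
      (d * τ ^ (d - 1) * ψ (AffineMap.homothety (b i) τ z) +
        τ ^ d * fderiv ℝ ψ (AffineMap.homothety (b i) τ z) (z - b i)) τ := by
    intro τ _
    have h1 : HasDerivAt (fun τ : ℝ => AffineMap.homothety (b i) τ z) (z - b i) τ := by
      simp only [AffineMap.homothety_apply, vsub_eq_sub, vadd_eq_add]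
      simpa using ((hasDerivAt_id τ).smul_const (z - b i)).add_const (b i)
    exact (hasDerivAt_pow d τ).mul
      ((hψ.differentiable one_ne_zero _).hasFDerivAt.comp_hasDerivAt τ h1)
  have hcz : Continuous fun τ : ℝ => AffineMap.homothety (b i) τ z :=
    hm.comp (by fun_prop : Continuous fun τ : ℝ => (τ, z))
  have hI : IntervalIntegrable (fun τ : ℝ => d * τ ^ (d - 1) * ψ (AffineMap.homothety (b i) τ z) +
        τ ^ d * fderiv ℝ ψ (AffineMap.homothety (b i) τ z) (z - b i)) volume 0 1 := by
    refine Continuous.intervalIntegrable ?_ _ _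
    have := (hψ.continuous_fderiv one_ne_zero).comp hcz
    have := hψ.continuous.comp hcz
    simp only [Function.comp_def] at *
    fun_prop
  have := intervalIntegral.integral_eq_sub_of_hasDerivAt hderiv hI
  simp only [one_pow, AffineMap.homothety_one, AffineMap.id_apply, one_mul, zero_pow hd, zero_mul,
    sub_zero] at this
  rw [← this]
  refine intervalIntegral.integral_congr fun τ hτ => ?_
  rw [uIcc_of_le zero_le_one] at hτ
  simp only [smul_eq_mul]
  rw [ENNReal.toReal_ofReal (pow_nonneg hτ.1 _)]
  have h2 : AffineMap.homothety (b i) τ z - b i = τ • (z - b i) := by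
    simp [AffineMap.homothety_apply]
  rw [h2, map_smul, smul_eq_mul]
  obtain ⟨m, rfl⟩ := Nat.exists_eq_succ_of_ne_zero hd
  simp only [Nat.succ_sub_one, pow_succ]
  ring

/-- The outward unit normal on a face of a simplex. -/
def faceNormal (i : ι) : Euc d := -(‖coordGrad b i‖⁻¹ • coordGrad b i)

/-- The divergence theorem on a simplex. -/
lemma integral_simplexBody_fderiv (hd : d ≠ 0) [Nontrivial ι] {ψ : Euc d → ℝ}
    (hψ : ContDiff ℝ 1 ψ) (e : Euc d) :
    ∫ x in simplexBody b, fderiv ℝ ψ x e =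
      ∑ i, inner ℝ (faceNormal b i) e * ∫ x in simplexFace b i, ψ x ∂(surf d) := by
  have hc := hψ.continuous_fderiv one_ne_zero
  have hc' := hψ.continuous
  -- The length of the altitude is `‖coordGrad b i‖⁻¹`, which absorbs the normalisation of the
  -- normal, so each face term is a volume integral of a radial field.
  have h1 : ∀ i, inner ℝ (faceNormal b i) e * ∫ x in simplexFace b i, ψ x ∂(surf d) =
      ∫ x in simplexBody b, - inner ℝ (coordGrad b i) e *
        (d * ψ x + fderiv ℝ ψ x (x - b i)) := by
    intro i
    rw [integral_const_mul, integral_simplexBody_cone b hd i hψ, norm_altitude, faceNormal,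
      inner_neg_left, real_inner_smul_left]
    ring
  simp_rw [h1]
  rw [← integral_finsetSum]
  swap
  · intro i _
    refine ContinuousOn.integrableOn_compact (isCompact_simplexBody b) (Continuous.continuousOn ?_)
    fun_prop
  refine integral_congr_ae (Eventually.of_forall fun x => ?_)
  simp only
  -- The coordinates sum to one and reproduce the point; differentiating both identities in
  -- direction `e` gives `hsum` and `hpts`. Hence `e` is a combination of the radial vectors `x - b
  -- i` whose coefficients sum to zero, so the terms `d * ψ x` cancel.
  have hsum : ∑ i, inner ℝ (coordGrad b i) e = 0 := by
    have h2 := b.sum_coord_apply_eq_one x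
    have h3 := b.sum_coord_apply_eq_one (x + e)
    simp_rw [coord_add, Finset.sum_add_distrib] at h3
    linarith
  have hpts : ∑ i, inner ℝ (coordGrad b i) e • b i = e := by
    have h2 := b.linear_combination_coord_eq_self x
    have h3 := b.linear_combination_coord_eq_self (x + e)
    simp_rw [coord_add, add_smul, Finset.sum_add_distrib] at h3
    rw [h2] at h3
    exact add_left_cancel h3
  have hx : ∑ i, -inner ℝ (coordGrad b i) e • (x - b i) = e := by
    simp_rw [smul_sub, Finset.sum_sub_distrib, ← Finset.sum_smul, Finset.sum_neg_distrib, hsum,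
      neg_smul, Finset.sum_neg_distrib, hpts]
    simp
  calc fderiv ℝ ψ x e = fderiv ℝ ψ x (∑ i, -inner ℝ (coordGrad b i) e • (x - b i)) := by rw [hx]
    _ = _ := by
      rw [map_sum]
      simp_rw [map_smul, mul_add, Finset.sum_add_distrib, ← Finset.sum_mul,
        Finset.sum_neg_distrib, hsum]
      simp

end Simplex

/-! ### Convergence in `L²` -/

section L2

variable {α : Type*} [MeasurableSpace α] {μ : Measure α}

/-- Joint continuity of the inner product of `L²`. -/
lemma tendsto_integral_mul_of_L2 {f g : ℕ → α → ℝ} {f₀ g₀ : α → ℝ}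
    (hf : ∀ n, MemLp (f n) 2 μ) (hg : ∀ n, MemLp (g n) 2 μ) (hf₀ : MemLp f₀ 2 μ)
    (hg₀ : MemLp g₀ 2 μ)
    (hfl : Tendsto (fun n => eLpNorm (fun x => f n x - f₀ x) 2 μ) atTop (𝓝 0))
    (hgl : Tendsto (fun n => eLpNorm (fun x => g n x - g₀ x) 2 μ) atTop (𝓝 0)) :
    Tendsto (fun n => ∫ x, f n x * g n x ∂μ) atTop (𝓝 (∫ x, f₀ x * g₀ x ∂μ)) := by
  have h1 := (Lp.tendsto_Lp_iff_tendsto_eLpNorm'' f hf f₀ hf₀).2 hfl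
  have h2 := (Lp.tendsto_Lp_iff_tendsto_eLpNorm'' g hg g₀ hg₀).2 hgl
  have h3 := h1.inner h2 (𝕜 := ℝ)
  have e : ∀ {a c : α → ℝ} (ha : MemLp a 2 μ) (hc : MemLp c 2 μ),
      inner ℝ (ha.toLp a) (hc.toLp c) = ∫ x, a x * c x ∂μ := by
    intro a c ha hc
    rw [L2.inner_def]
    refine integral_congr_ae ?_
    filter_upwards [ha.coeFn_toLp, hc.coeFn_toLp] with x hx hy
    simp [hx, hy, mul_comm]
  simpa only [e] using h3

lemma exists_L2_limit {f : ℕ → α → ℝ} (hf : ∀ n, MemLp (f n) 2 μ)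
    (hc : Tendsto (fun p : ℕ × ℕ => eLpNorm (fun x => f p.1 x - f p.2 x) 2 μ) atTop (𝓝 0)) :
    ∃ f₀, MemLp f₀ 2 μ ∧
      Tendsto (fun n => eLpNorm (fun x => f n x - f₀ x) 2 μ) atTop (𝓝 0) := by
  have h1 : CauchySeq fun n => (hf n).toLp (f n) := by
    refine (Lp.cauchySeq_Lp_iff_cauchySeq_eLpNorm _).2 (hc.congr fun p => eLpNorm_congr_ae ?_)
    filter_upwards [(hf p.1).coeFn_toLp, (hf p.2).coeFn_toLp] with x h1 h2
    rw [Pi.sub_apply, h1, h2]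
  obtain ⟨F, hF⟩ := cauchySeq_tendsto_of_complete h1
  refine ⟨F, Lp.memLp F, ?_⟩
  rw [← Lp.toLp_coeFn F (Lp.memLp F)] at hF
  exact (Lp.tendsto_Lp_iff_tendsto_eLpNorm'' f hf F (Lp.memLp F)).1 hF

lemma L2_limit_ae_unique {f : ℕ → α → ℝ} {g g' : α → ℝ} (hf : ∀ n, AEStronglyMeasurable (f n) μ)
    (hg : MemLp g 2 μ) (hg' : MemLp g' 2 μ)
    (h : Tendsto (fun n => eLpNorm (fun x => f n x - g x) 2 μ) atTop (𝓝 0))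
    (h' : Tendsto (fun n => eLpNorm (fun x => f n x - g' x) 2 μ) atTop (𝓝 0)) : g =ᵐ[μ] g' := by
  have h0 : eLpNorm (fun x => g x - g' x) 2 μ = 0 := by
    refine le_antisymm (ge_of_tendsto (x := atTop) (by simpa using h.add h')
      (Eventually.of_forall fun n => ?_)) bot_le
    have : (fun x => g x - g' x) = (fun x => f n x - g' x) - fun x => f n x - g x := by
      ext x; simp
    rw [this, add_comm]
    exact eLpNorm_sub_le ((hf n).sub hg'.1) ((hf n).sub hg.1) (by norm_num)
  have h1 := (eLpNorm_eq_zero_iff (hg.1.sub hg'.1) (by norm_num)).1 h0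
  filter_upwards [h1] with x hx
  exact sub_eq_zero.1 hx

lemma L2_tendsto_sub {f : ℕ → α → ℝ} {f' : ℕ → α → ℝ} {g g' : α → ℝ}
    (hf : ∀ n, AEStronglyMeasurable (f n) μ) (hf' : ∀ n, AEStronglyMeasurable (f' n) μ)
    (hg : AEStronglyMeasurable g μ) (hg' : AEStronglyMeasurable g' μ)
    (h : Tendsto (fun n => eLpNorm (fun x => f n x - g x) 2 μ) atTop (𝓝 0))
    (h' : Tendsto (fun n => eLpNorm (fun x => f' n x - g' x) 2 μ) atTop (𝓝 0)) :
    Tendsto (fun n => eLpNorm (fun x => (f n x - f' n x) - (g x - g' x)) 2 μ) atTop (𝓝 0) := by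
  refine tendsto_of_tendsto_of_tendsto_of_le_of_le tendsto_const_nhds (by simpa using h.add h')
    (fun _ => bot_le) fun n => ?_
  have : (fun x => (f n x - f' n x) - (g x - g' x)) =
      (fun x => f n x - g x) - fun x => f' n x - g' x := by
    ext x; simp only [Pi.sub_apply]; ring
  rw [this]
  exact eLpNorm_sub_le ((hf n).sub hg) ((hf' n).sub hg') (by norm_num)

lemma L2_cauchy_of_tendsto {f : ℕ → α → ℝ} {g : α → ℝ}
    (hf : ∀ n, AEStronglyMeasurable (f n) μ) (hg : AEStronglyMeasurable g μ)
    (h : Tendsto (fun n => eLpNorm (fun x => f n x - g x) 2 μ) atTop (𝓝 0)) :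
    Tendsto (fun p : ℕ × ℕ => eLpNorm (fun x => f p.1 x - f p.2 x) 2 μ) atTop (𝓝 0) := by
  rw [← prod_atTop_atTop_eq]
  refine tendsto_of_tendsto_of_tendsto_of_le_of_le tendsto_const_nhds
    (by simpa using (h.comp tendsto_fst).add (h.comp tendsto_snd)) (fun _ => bot_le) fun p => ?_
  have : (fun x => f p.1 x - f p.2 x) = (fun x => f p.1 x - g x) - fun x => f p.2 x - g x := by
    ext x; simp
  rw [this]
  exact eLpNorm_sub_le ((hf p.1).sub hg) ((hf p.2).sub hg) (by norm_num)

end L2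

/-! ### Weak derivatives -/

lemma continuous_partialDeriv {ψ : Euc d → ℝ} (hψ : ContDiff ℝ ∞ ψ) (i : Fin d) :
    Continuous (partialDeriv i ψ) := by
  have := hψ.continuous_fderiv (by simp)
  unfold partialDeriv
  fun_prop

lemma hasCompactSupport_partialDeriv {ψ : Euc d → ℝ} (hc : HasCompactSupport ψ) (i : Fin d) :
    HasCompactSupport (partialDeriv i ψ) :=
  hc.fderiv_apply (𝕜 := ℝ) _

lemma tsupport_partialDeriv_subset (ψ : Euc d → ℝ) (i : Fin d) :
    tsupport (partialDeriv i ψ) ⊆ tsupport ψ :=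
  tsupport_fderiv_apply_subset ℝ _

lemma partialDeriv_mul {f g : Euc d → ℝ} (hf : ContDiff ℝ ∞ f) (hg : ContDiff ℝ ∞ g) (i : Fin d)
    (x : Euc d) : partialDeriv i (fun y => f y * g y) x =
      f x * partialDeriv i g x + g x * partialDeriv i f x := by
  simp [partialDeriv, fderiv_fun_mul (hf.differentiable (by simp) x) (hg.differentiable (by simp) x)]

lemma memLp_of_continuous_of_isBounded {D : Set (Euc d)} (hD : Bornology.IsBounded D)
    {μ : Measure (Euc d)} [IsFiniteMeasure (μ.restrict D)] {f : Euc d → ℝ} (hf : Continuous f) :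
    MemLp f 2 (μ.restrict D) := by
  obtain ⟨C, hC⟩ := (hD.isCompact_closure.image hf).isBounded.exists_norm_le
  refine MemLp.of_bound hf.aestronglyMeasurable C ?_
  refine ae_restrict_of_ae_restrict_of_subset subset_closure ?_
  refine (ae_restrict_iff' isClosed_closure.measurableSet).2 (Eventually.of_forall fun x hx => ?_)
  exact hC _ (mem_image_of_mem f hx)

lemma isFiniteMeasure_restrict_volume {D : Set (Euc d)} (hD : Bornology.IsBounded D) :
    IsFiniteMeasure (volume.restrict D) := ⟨by simpa using hD.measure_lt_top⟩

section Weak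

variable {D U : Set (Euc d)} {i : Fin d} {v w g g' : Euc d → ℝ}

lemma IsWeakPartial.congr (h : IsWeakPartial D i v g) (hv : v =ᵐ[volume.restrict D] w)
    (hg : g =ᵐ[volume.restrict D] g') : IsWeakPartial D i w g' := by
  refine ⟨h.1.ae_eq hg, fun ψ h1 h2 h3 => ?_⟩
  refine (integral_congr_ae (hv.mul (ae_eq_refl (partialDeriv i ψ)))).symm.trans ?_
  exact (h.2 ψ h1 h2 h3).trans (congrArg _ (integral_congr_ae (hg.mul (ae_eq_refl ψ))))

lemma memLp_test {μ : Measure (Euc d)} [IsFiniteMeasureOnCompacts μ] {ψ : Euc d → ℝ}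
    (hψ : Continuous ψ) (hc : HasCompactSupport ψ) : MemLp ψ 2 (μ.restrict D) :=
  (hψ.memLp_of_hasCompactSupport hc).restrict D

/-- Fundamental lemma of the calculus of variations, applied to `g - g'`. It makes the choice inside
`weakPartial` harmless. -/
lemma IsWeakPartial.ae_unique (hD : IsOpen D) (h : IsWeakPartial D i v g)
    (h' : IsWeakPartial D i v g') : g =ᵐ[volume.restrict D] g' := by
  have hsub : MemLp (g - g') 2 (volume.restrict D) := h.1.sub h'.1
  have key := hD.ae_eq_zero_of_integral_contDiff_smul_eq_zero (μ := volume) (f := g - g') ?_ ?_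
  · rw [Filter.EventuallyEq, ae_restrict_iff' hD.measurableSet]
    filter_upwards [key] with x hx hxD
    exact sub_eq_zero.1 (hx hxD)
  · exact locallyIntegrableOn_of_locallyIntegrable_restrict
      (hsub.locallyIntegrable (by norm_num))
  · intro ψ h1 h2 h3
    have e : ∫ x, ψ x • (g - g') x = ∫ x in D, ψ x • (g - g') x := by
      refine (setIntegral_eq_integral_of_forall_compl_eq_zero fun x hx => ?_).symm
      rw [image_eq_zero_of_notMem_tsupport fun hx' => hx (h3 hx'), zero_smul]
    rw [e]
    have hm := memLp_test (D := D) (μ := volume) h1.continuous h2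
    have e2 : ∀ x, ψ x • (g - g') x = g x * ψ x - g' x * ψ x := fun x => by
      simp only [smul_eq_mul, Pi.sub_apply]; ring
    simp_rw [e2]
    have i1 : Integrable (fun x => g x * ψ x) (volume.restrict D) := h.1.integrable_mul hm
    have i2 : Integrable (fun x => g' x * ψ x) (volume.restrict D) := h'.1.integrable_mul hm
    rw [integral_sub i1 i2]
    have := h.2 ψ h1 h2 h3
    rw [h'.2 ψ h1 h2 h3] at this
    linarith

/-- A test function supported in `U` is also a test function on `D`, and both integrals see only its
support. -/
lemma IsWeakPartial.mono (hU : U ⊆ D) (h : IsWeakPartial D i v g) : IsWeakPartial U i v g := by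
  refine ⟨h.1.mono_measure (Measure.restrict_mono hU le_rfl), fun ψ h1 h2 h3 => ?_⟩
  have e : ∀ (f k : Euc d → ℝ), tsupport k ⊆ U →
      ∫ x in D, f x * k x = ∫ x in U, f x * k x := by
    intro f k hk
    rw [setIntegral_eq_integral_of_forall_compl_eq_zero,
      setIntegral_eq_integral_of_forall_compl_eq_zero]
    · intro x hx
      rw [image_eq_zero_of_notMem_tsupport fun hx' => hx (hk hx'), mul_zero]
    · intro x hx
      rw [image_eq_zero_of_notMem_tsupport fun hx' => hx (hU (hk hx')), mul_zero]
  rw [← e v _ ((tsupport_partialDeriv_subset ψ i).trans h3), ← e g _ h3]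
  exact h.2 ψ h1 h2 (h3.trans hU)

lemma IsWeakPartial.add (hv : MemL2 D v) (hw : MemL2 D w) (h : IsWeakPartial D i v g)
    (h' : IsWeakPartial D i w g') : IsWeakPartial D i (v + w) (g + g') := by
  refine ⟨h.1.add h'.1, fun ψ h1 h2 h3 => ?_⟩
  have hm := memLp_test (D := D) (μ := volume) h1.continuous h2
  have hm' := memLp_test (D := D) (μ := volume) (continuous_partialDeriv h1 i)
    (hasCompactSupport_partialDeriv h2 i)
  simp only [Pi.add_apply, add_mul]
  have i1 : Integrable (fun x => v x * partialDeriv i ψ x) (volume.restrict D) :=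
    hv.integrable_mul hm'
  have i2 : Integrable (fun x => w x * partialDeriv i ψ x) (volume.restrict D) :=
    hw.integrable_mul hm'
  have i3 : Integrable (fun x => g x * ψ x) (volume.restrict D) := h.1.integrable_mul hm
  have i4 : Integrable (fun x => g' x * ψ x) (volume.restrict D) := h'.1.integrable_mul hm
  rw [integral_add i1 i2, integral_add i3 i4, h.2 ψ h1 h2 h3, h'.2 ψ h1 h2 h3]
  ring

lemma isWeakPartial_weakPartial (h : MemH1 D v) (i : Fin d) :
    IsWeakPartial D i v (weakPartial D i v) := by
  rw [weakPartial, dif_pos (h.2 i)]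
  exact (h.2 i).choose_spec

lemma MemH1.memL2_weakPartial (h : MemH1 D v) (i : Fin d) : MemL2 D (weakPartial D i v) :=
  (isWeakPartial_weakPartial h i).1

lemma IsWeakPartial.weakPartial_ae_eq (hD : IsOpen D) (h : IsWeakPartial D i v g) :
    weakPartial D i v =ᵐ[volume.restrict D] g := by
  have : ∃ g, IsWeakPartial D i v g := ⟨g, h⟩
  rw [weakPartial, dif_pos this]
  exact this.choose_spec.ae_unique hD h

lemma MemH1.mono (hU : U ⊆ D) (h : MemH1 D v) : MemH1 U v :=
  ⟨h.1.mono_measure (Measure.restrict_mono hU le_rfl), fun i =>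
    ⟨_, (isWeakPartial_weakPartial h i).mono hU⟩⟩

lemma weakPartial_mono_ae_eq (hUo : IsOpen U) (hU : U ⊆ D) (h : MemH1 D v) (i : Fin d) :
    weakPartial U i v =ᵐ[volume.restrict U] weakPartial D i v :=
  ((isWeakPartial_weakPartial h i).mono hU).weakPartial_ae_eq hUo

lemma MemH1.add (hv : MemH1 D v) (hw : MemH1 D w) : MemH1 D (v + w) :=
  ⟨hv.1.add hw.1, fun i => ⟨_, (isWeakPartial_weakPartial hv i).add hv.1 hw.1
    (isWeakPartial_weakPartial hw i)⟩⟩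

/-- The test function has compact support in `D`, so the integrals extend to the whole space, where
integration by parts has no boundary term. Boundedness of `D` puts the classical derivative in `L²`.
-/
lemma isWeakPartial_partialDeriv (hDb : Bornology.IsBounded D)
    {ψ : Euc d → ℝ} (hψ : ContDiff ℝ ∞ ψ) (i : Fin d) :
    IsWeakPartial D i ψ (partialDeriv i ψ) := by
  have := isFiniteMeasure_restrict_volume hDb
  refine ⟨memLp_of_continuous_of_isBounded hDb (continuous_partialDeriv hψ i),
    fun η h1 h2 h3 => ?_⟩
  rw [setIntegral_eq_integral_of_forall_compl_eq_zero,
    setIntegral_eq_integral_of_forall_compl_eq_zero]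
  · refine integral_mul_fderiv_eq_neg_fderiv_mul_of_integrable ?_ ?_ ?_
      (fun x _ => hψ.differentiable (by simp) x) (fun x _ => h1.differentiable (by simp) x)
    · exact ((continuous_partialDeriv hψ i).mul h1.continuous).integrable_of_hasCompactSupport
        h2.mul_left
    · exact (hψ.continuous.mul (continuous_partialDeriv h1 i)).integrable_of_hasCompactSupport
        (hasCompactSupport_partialDeriv h2 i).mul_left
    · exact (hψ.continuous.mul h1.continuous).integrable_of_hasCompactSupport h2.mul_left
  · intro x hx
    rw [image_eq_zero_of_notMem_tsupport fun hx' => hx (h3 hx'), mul_zero]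
  · intro x hx
    rw [image_eq_zero_of_notMem_tsupport fun hx' =>
      hx (h3 (tsupport_partialDeriv_subset η i hx')), mul_zero]

lemma memH1_of_contDiff (hDb : Bornology.IsBounded D)
    {ψ : Euc d → ℝ} (hψ : ContDiff ℝ ∞ ψ) : MemH1 D ψ := by
  have := isFiniteMeasure_restrict_volume hDb
  exact ⟨memLp_of_continuous_of_isBounded hDb hψ.continuous,
    fun i => ⟨_, isWeakPartial_partialDeriv hDb hψ i⟩⟩

/-- A sequence of smooth functions converges to `v` in `H¹(D)`. -/
structure TendstoH1 (D : Set (Euc d)) (ψ : ℕ → Euc d → ℝ) (v : Euc d → ℝ) : Prop where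
  smooth : ∀ n, ContDiff ℝ ∞ (ψ n)
  val : Tendsto (fun n => eLpNorm (fun x => ψ n x - v x) 2 (volume.restrict D)) atTop (𝓝 0)
  grad : ∀ i, Tendsto (fun n => eLpNorm (fun x => partialDeriv i (ψ n) x - weakPartial D i v x) 2
    (volume.restrict D)) atTop (𝓝 0)

lemma hasTrace_iff {S : Set (Euc d)} : HasTrace D S v g ↔ MemH1 D v ∧
    MemLp g 2 ((surf d).restrict S) ∧ ∃ ψ, TendstoH1 D ψ v ∧
      Tendsto (fun n => eLpNorm (fun x => ψ n x - g x) 2 ((surf d).restrict S)) atTop (𝓝 0) :=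
  ⟨fun ⟨h1, h2, ψ, h3, h4, h5, h6⟩ => ⟨h1, h2, ψ, ⟨h3, h4, h5⟩, h6⟩,
    fun ⟨h1, h2, ψ, h3, h6⟩ => ⟨h1, h2, ψ, h3.1, h3.2, h3.3, h6⟩⟩

lemma TendstoH1.mono {ψ : ℕ → Euc d → ℝ} (h : TendstoH1 D ψ v) (hv : MemH1 D v) (hUo : IsOpen U)
    (hU : U ⊆ D) : TendstoH1 U ψ v := by
  refine ⟨h.smooth, ?_, fun i => ?_⟩
  · exact tendsto_of_tendsto_of_tendsto_of_le_of_le tendsto_const_nhds h.val (fun _ => bot_le)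
      fun n => eLpNorm_mono_measure _ (Measure.restrict_mono hU le_rfl)
  · refine tendsto_of_tendsto_of_tendsto_of_le_of_le tendsto_const_nhds (h.grad i)
      (fun _ => bot_le) fun n => ?_
    refine le_trans (le_of_eq (eLpNorm_congr_ae ?_))
      (eLpNorm_mono_measure _ (Measure.restrict_mono hU le_rfl))
    filter_upwards [weakPartial_mono_ae_eq hUo hU hv i] with x hx
    rw [hx]

lemma HasTrace.mono {S S' : Set (Euc d)} (h : HasTrace D S v g) (hUo : IsOpen U) (hU : U ⊆ D)
    (hS : S' ⊆ S) : HasTrace U S' v g := by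
  obtain ⟨h1, h2, ψ, h3, h4⟩ := hasTrace_iff.1 h
  refine hasTrace_iff.2 ⟨h1.mono hU, h2.mono_measure (Measure.restrict_mono hS le_rfl), ψ,
    h3.mono h1 hUo hU, ?_⟩
  exact tendsto_of_tendsto_of_tendsto_of_le_of_le tendsto_const_nhds h4 (fun _ => bot_le)
    fun n => eLpNorm_mono_measure _ (Measure.restrict_mono hS le_rfl)

lemma HasTrace.congr {S : Set (Euc d)} (h : HasTrace D S v g)
    (hg : g =ᵐ[(surf d).restrict S] g') : HasTrace D S v g' := by
  obtain ⟨h1, h2, ψ, h3, h4⟩ := hasTrace_iff.1 h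
  refine hasTrace_iff.2 ⟨h1, h2.ae_eq hg, ψ, h3, h4.congr fun n => eLpNorm_congr_ae ?_⟩
  filter_upwards [hg] with x hx
  rw [hx]

lemma hasTrace_of_contDiff {S : Set (Euc d)} (hDo : IsOpen D) (hDb : Bornology.IsBounded D)
    {ψ : Euc d → ℝ} (hψ : ContDiff ℝ ∞ ψ) (hS : MemLp ψ 2 ((surf d).restrict S)) :
    HasTrace D S ψ ψ := by
  refine hasTrace_iff.2 ⟨memH1_of_contDiff hDb hψ, hS, fun _ => ψ, ⟨fun _ => hψ, ?_, fun i => ?_⟩,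
    ?_⟩
  · simp
  · have : (fun x => partialDeriv i ψ x - weakPartial D i ψ x) =ᵐ[volume.restrict D] 0 := by
      filter_upwards [(isWeakPartial_partialDeriv hDb hψ i).weakPartial_ae_eq hDo] with x hx
      simp [hx]
    simp [eLpNorm_congr_ae this]
  · simp

end Weak

/-! ### Approximation by smooth functions on convex domains -/

section Density

lemma map_smul_add {c : ℝ} (hc : c ≠ 0) (w : Euc d) :
    (volume : Measure (Euc d)).map (fun x => c • x + w) =
      ENNReal.ofReal |(c ^ d)⁻¹| • volume := by
  have : (fun x : Euc d => c • x + w) = (fun x => x + w) ∘ fun x => c • x := rfl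
  rw [this, ← Measure.map_map (by fun_prop) (by fun_prop), Measure.map_addHaar_smul _ hc,
    Measure.map_smul, map_add_right_eq_self]
  simp

lemma eLpNorm_comp_affine {c : ℝ} (hc : c ≠ 0) (w : Euc d) {f : Euc d → ℝ}
    (hf : AEStronglyMeasurable f volume) :
    eLpNorm (fun x => f (c • x + w)) 2 volume =
      ENNReal.ofReal |(c ^ d)⁻¹| ^ (1 / (2 : ENNReal)).toReal * eLpNorm f 2 volume := by
  rw [← smul_eq_mul, ← eLpNorm_smul_measure_of_ne_top (by norm_num), ← map_smul_add hc w,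
    eLpNorm_map_measure _ (by fun_prop)]
  · rfl
  · rw [map_smul_add hc w]; exact hf.smul_measure _

lemma quasiMeasurePreserving_affine {c : ℝ} (hc : c ≠ 0) (w : Euc d) :
    Measure.QuasiMeasurePreserving (fun x : Euc d => c • x + w) volume volume :=
  ⟨by fun_prop, by rw [map_smul_add hc w]; exact Measure.smul_absolutelyContinuous⟩

lemma memLp_comp_affine {c : ℝ} (hc : c ≠ 0) (w : Euc d) {f : Euc d → ℝ}
    (hf : MemLp f 2 volume) : MemLp (fun x => f (c • x + w)) 2 volume := by
  refine ⟨hf.1.comp_quasiMeasurePreserving (quasiMeasurePreserving_affine hc w), ?_⟩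
  rw [eLpNorm_comp_affine hc w hf.1]
  exact ENNReal.mul_lt_top (ENNReal.rpow_lt_top_of_nonneg (by positivity) (by simp)) hf.2

/-- A smooth probability density with compact support in `D`. -/
structure IsSmoothDensity (D : Set (Euc d)) (ρ : Euc d → ℝ) : Prop where
  smooth : ContDiff ℝ ∞ ρ
  compact : HasCompactSupport ρ
  supp : tsupport ρ ⊆ D
  nonneg : ∀ x, 0 ≤ ρ x
  integral : ∫ x, ρ x = 1

lemma exists_isSmoothDensity {D : Set (Euc d)} (hD : IsOpen D) (hne : D.Nonempty) :
    ∃ ρ, IsSmoothDensity D ρ := by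
  obtain ⟨c, hc⟩ := hne
  obtain ⟨r, hr, hrD⟩ := Metric.nhds_basis_closedBall.mem_iff.1 (hD.mem_nhds hc)
  let φ : ContDiffBump c := ⟨r / 2, r, by positivity, by linarith⟩
  refine ⟨φ.normed volume, φ.contDiff_normed, φ.hasCompactSupport_normed, ?_, φ.nonneg_normed,
    φ.integral_normed⟩
  rw [φ.tsupport_normed_eq]
  exact hrD

/-- The weighted mean of the values of `f` on the copy of the support of `ρ` that is contracted
towards `x` by the factor `t`. -/
def smear (ρ : Euc d → ℝ) (t : ℝ) (f : Euc d → ℝ) (x : Euc d) : ℝ :=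
  ∫ y, ρ y * f ((1 - t) • x + t • y)

/-- The convolution kernel of `smear`. -/
def smearKernel (ρ : Euc d → ℝ) (t : ℝ) (w : Euc d) : ℝ := (t ^ d)⁻¹ * ρ (-(t⁻¹ • w))

variable {D : Set (Euc d)} {ρ f v g : Euc d → ℝ} {t : ℝ}

/-- Substitute `z = (1 - t) • x + t • y`; the Jacobian `t ^ d` is absorbed in the kernel. All
dependence on `x` now sits in the smooth kernel. -/
lemma smear_eq_integral (ht : 0 < t) (x : Euc d) :
    smear ρ t f x = ∫ z, f z * smearKernel ρ t ((1 - t) • x - z) := by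
  rw [← integral_add_left_eq_self _ ((1 - t) • x)]
  have h := Measure.integral_comp_smul_of_nonneg (volume : Measure (Euc d))
    (fun z => f ((1 - t) • x + z) * smearKernel ρ t ((1 - t) • x - ((1 - t) • x + z))) t
    (hR := ht.le)
  rw [finrank_euclideanSpace, Fintype.card_fin, smul_eq_mul, eq_comm,
    inv_mul_eq_iff_eq_mul₀ (by positivity)] at h
  rw [h, ← integral_const_mul, smear]
  refine integral_congr_ae (Eventually.of_forall fun y => ?_)
  have : -(t⁻¹ • ((1 - t) • x - ((1 - t) • x + t • y))) = y := by
    rw [sub_add_cancel_left, smul_neg, neg_neg, smul_smul, inv_mul_cancel₀ ht.ne', one_smul]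
  simp only [smearKernel, this]
  field_simp

lemma contDiff_smearKernel (hρ : ContDiff ℝ ∞ ρ) : ContDiff ℝ ∞ (smearKernel ρ t) :=
  contDiff_const.mul (hρ.comp (by fun_prop : ContDiff ℝ ∞ fun w : Euc d => -(t⁻¹ • w)))

lemma hasCompactSupport_smearKernel (ht : 0 < t) (hρ : HasCompactSupport ρ) :
    HasCompactSupport (smearKernel ρ t) := by
  refine HasCompactSupport.mul_left ?_
  exact hρ.comp_homeomorph ((Homeomorph.smulOfNeZero t⁻¹ (inv_ne_zero ht.ne')).trans
    (Homeomorph.neg (Euc d)))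

lemma smear_eq_convolution (ht : 0 < t) :
    smear ρ t f = fun x => convolution f (smearKernel ρ t) (ContinuousLinearMap.mul ℝ ℝ) volume
      ((1 - t) • x) := by
  ext x
  rw [smear_eq_integral ht, convolution_def]
  rfl

lemma contDiff_smear (ht : 0 < t) (hρ : IsSmoothDensity D ρ) (hf : LocallyIntegrable f volume) :
    ContDiff ℝ ∞ (smear ρ t f) := by
  rw [smear_eq_convolution ht]
  exact ((hasCompactSupport_smearKernel ht hρ.compact).contDiff_convolution_right _ hf
    (contDiff_smearKernel hρ.smooth)).comp
    (by fun_prop : ContDiff ℝ ∞ fun x : Euc d => (1 - t) • x)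

lemma locallyIntegrable_indicator (hD : IsOpen D) (hv : MemL2 D v) :
    LocallyIntegrable (D.indicator v) volume :=
  ((memLp_indicator_iff_restrict hD.measurableSet).2 hv).locallyIntegrable (by norm_num)

lemma integral_indicator_mul (hD : IsOpen D) (a c : Euc d → ℝ) :
    ∫ z, D.indicator a z * c z = ∫ z in D, a z * c z := by
  rw [← integral_indicator hD.measurableSet]
  refine integral_congr_ae (Eventually.of_forall fun z => ?_)
  by_cases hz : z ∈ D <;> simp [hz]

/-- As a function of `z`, the kernel is supported in `(1 - t) • x + t • tsupport ρ`, which convexity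
keeps inside `D`. It is therefore an admissible test function, and the derivative passes from the
kernel to `v`; the factor `1 - t` is the chain rule. -/
lemma partialDeriv_smear (hD : IsOpen D) (hconv : Convex ℝ D) (ht : 0 < t) (ht1 : t < 1)
    (hρ : IsSmoothDensity D ρ) {i : Fin d} (hv : MemL2 D v) (h : IsWeakPartial D i v g)
    {x : Euc d} (hx : x ∈ D) :
    partialDeriv i (smear ρ t (D.indicator v)) x = (1 - t) * smear ρ t (D.indicator g) x := by
  have hkc := hasCompactSupport_smearKernel ht hρ.compact
  have hks := contDiff_smearKernel (t := t) hρ.smooth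
  have hli := locallyIntegrable_indicator hD hv
  set e : Euc d := EuclideanSpace.single i (1 : ℝ)
  have h1 := hkc.hasFDerivAt_convolution_right (ContinuousLinearMap.mul ℝ ℝ) hli
    (hks.of_le (by simp)) ((1 - t) • x)
  have h2 : HasFDerivAt (fun x : Euc d => (1 - t) • x) ((1 - t) • ContinuousLinearMap.id ℝ _) x :=
    (hasFDerivAt_id x).const_smul (1 - t)
  have h3 : HasFDerivAt (fun x => convolution (D.indicator v) (smearKernel ρ t)
      (ContinuousLinearMap.mul ℝ ℝ) volume ((1 - t) • x)) _ x := h1.comp x h2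
  rw [partialDeriv, smear_eq_convolution ht, HasFDerivAt.fderiv h3, ContinuousLinearMap.comp_apply,
    smul_apply, map_smul, smul_eq_mul, ContinuousLinearMap.id_apply,
    convolution_precompR_apply _ hli (hkc.fderiv ℝ) (hks.continuous_fderiv (by simp)),
    convolution_def, smear_eq_integral ht]
  congr 1
  simp only [ContinuousLinearMap.mul_apply']
  rw [integral_indicator_mul hD, integral_indicator_mul hD]
  have hψs : ContDiff ℝ ∞ fun z => smearKernel ρ t ((1 - t) • x - z) :=
    hks.comp (contDiff_const.sub contDiff_id)
  have hpd : ∀ z, partialDeriv i (fun z => smearKernel ρ t ((1 - t) • x - z)) z =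
      - fderiv ℝ (smearKernel ρ t) ((1 - t) • x - z) e := by
    intro z
    have h4 : HasFDerivAt (fun z => smearKernel ρ t ((1 - t) • x - z))
        ((fderiv ℝ (smearKernel ρ t) ((1 - t) • x - z)).comp
          (-ContinuousLinearMap.id ℝ (Euc d))) z :=
      ((hks.differentiable (by simp)) _).hasFDerivAt.comp z
        ((hasFDerivAt_id z).const_sub ((1 - t) • x))
    rw [partialDeriv, h4.fderiv]
    simp [e]
  have hcs : HasCompactSupport fun z => smearKernel ρ t ((1 - t) • x - z) :=
    hkc.comp_homeomorph (Homeomorph.subLeft ((1 - t) • x))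
  have hsub : tsupport (fun z => smearKernel ρ t ((1 - t) • x - z)) ⊆ D := by
    have hK : IsClosed ((fun y => (1 - t) • x + t • y) '' tsupport ρ) :=
      (IsCompact.image hρ.compact (by fun_prop)).isClosed
    refine (closure_minimal ?_ hK).trans ?_
    · intro z hz
      have hz' : ρ (-(t⁻¹ • ((1 - t) • x - z))) ≠ 0 := fun h0 => hz (by simp [smearKernel, h0])
      refine ⟨_, subset_tsupport ρ hz', ?_⟩
      simp only [smul_neg, smul_smul, mul_inv_cancel₀ ht.ne', one_smul]
      abel
    · rintro _ ⟨y, hy, rfl⟩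
      exact hconv hx (hρ.supp hy) (by linarith) ht.le (by ring)
  have := h.2 _ hψs hcs hsub
  simp only [hpd, mul_neg, integral_neg, neg_inj] at this
  exact this

/-- The probability measure with density `ρ`. -/
def densityMeasure (ρ : Euc d → ℝ) : Measure (Euc d) :=
  volume.withDensity fun y => ENNReal.ofReal (ρ y)

lemma isProbabilityMeasure_densityMeasure (hρ : IsSmoothDensity D ρ) :
    IsProbabilityMeasure (densityMeasure ρ) := by
  constructor
  rw [densityMeasure, withDensity_apply _ MeasurableSet.univ, Measure.restrict_univ,
    ← ofReal_integral_eq_lintegral_ofReal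
      (hρ.smooth.continuous.integrable_of_hasCompactSupport hρ.compact)
      (Eventually.of_forall hρ.nonneg), hρ.integral, ENNReal.ofReal_one]

lemma ae_densityMeasure_mem (hρ : IsSmoothDensity D ρ) : ∀ᵐ y ∂(densityMeasure ρ), y ∈ D := by
  have hm : Measurable fun y => ENNReal.ofReal (ρ y) := by
    have := hρ.smooth.continuous.measurable
    fun_prop
  rw [densityMeasure, ae_withDensity_iff hm]
  refine Eventually.of_forall fun y hy => hρ.supp (subset_tsupport ρ fun h0 => hy (by simp [h0]))

lemma smear_eq_densityMeasure (hρ : IsSmoothDensity D ρ) (x : Euc d) :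
    smear ρ t f x = ∫ y, f ((1 - t) • x + t • y) ∂(densityMeasure ρ) := by
  have hm : Measurable fun y => ENNReal.ofReal (ρ y) := by
    have := hρ.smooth.continuous.measurable
    fun_prop
  rw [densityMeasure, integral_withDensity_eq_integral_toReal_smul hm (by simp), smear]
  simp [ENNReal.toReal_ofReal (hρ.nonneg _)]

lemma integrable_densityMeasure (hρ : IsSmoothDensity D ρ) (ht : 0 < t) (hf : MemLp f 2 volume)
    (x : Euc d) : Integrable (fun y => f ((1 - t) • x + t • y)) (densityMeasure ρ) := by
  have hm : Measurable fun y => ENNReal.ofReal (ρ y) := by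
    have := hρ.smooth.continuous.measurable
    fun_prop
  rw [densityMeasure, integrable_withDensity_iff_integrable_smul' hm (by simp)]
  have h1 := memLp_comp_affine ht.ne' ((1 - t) • x) hf
  have h2 : MemLp ρ 2 volume := hρ.smooth.continuous.memLp_of_hasCompactSupport hρ.compact
  have h3 : Integrable (fun y => ρ y * f (t • y + (1 - t) • x)) volume := h2.integrable_mul h1
  refine h3.congr (Eventually.of_forall fun y => ?_)
  simp [ENNReal.toReal_ofReal (hρ.nonneg _), add_comm]

lemma eLpNorm_two_sq {α : Type*} [MeasurableSpace α] {μ : Measure α} (f : α → ℝ) :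
    eLpNorm f 2 μ ^ 2 = ∫⁻ x, ‖f x‖ₑ ^ 2 ∂μ := by
  have := eLpNorm_nnreal_pow_eq_lintegral (μ := μ) (f := f) (p := 2) (by norm_num)
  simpa using this

lemma enorm_integral_sq_le {α : Type*} [MeasurableSpace α] {μ : Measure α}
    [IsProbabilityMeasure μ] {f : α → ℝ} (hf : AEStronglyMeasurable f μ) :
    ‖∫ x, f x ∂μ‖ₑ ^ 2 ≤ ∫⁻ x, ‖f x‖ₑ ^ 2 ∂μ := by
  rw [← eLpNorm_two_sq]
  gcongr
  refine (enorm_integral_le_lintegral_enorm f).trans ?_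
  rw [← eLpNorm_one_eq_lintegral_enorm]
  exact eLpNorm_le_eLpNorm_of_exponent_le (by norm_num) hf

/-- The smeared function is an average of the dilates `f ((1 - t) • x + t • y)` over a probability
measure in `y`. Jensen's inequality and Tonelli's theorem carry a bound uniform in `y` over to the
average. -/
lemma eLpNorm_smear_sub_le (hρ : IsSmoothDensity D ρ) (ht : 0 < t)
    (hfm : StronglyMeasurable f) (hf : MemLp f 2 volume) {ε : ENNReal}
    (h : ∀ y ∈ D, eLpNorm (fun x => f ((1 - t) • x + t • y) - f x) 2 (volume.restrict D) ≤ ε) :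
    eLpNorm (fun x => smear ρ t f x - f x) 2 (volume.restrict D) ≤ ε := by
  have := isProbabilityMeasure_densityMeasure hρ
  rw [← ENNReal.pow_le_pow_left_iff two_ne_zero, eLpNorm_two_sq]
  have e : ∀ x, smear ρ t f x - f x =
      ∫ y, (f ((1 - t) • x + t • y) - f x) ∂(densityMeasure ρ) := by
    intro x
    rw [integral_sub (integrable_densityMeasure hρ ht hf x) (integrable_const _),
      smear_eq_densityMeasure hρ]
    simp
  have hmeas : Measurable fun p : Euc d × Euc d => f ((1 - t) • p.1 + t • p.2) - f p.1 := by
    have := hfm.measurable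
    fun_prop
  calc ∫⁻ x in D, ‖smear ρ t f x - f x‖ₑ ^ 2
      ≤ ∫⁻ x in D, (∫⁻ y, ‖f ((1 - t) • x + t • y) - f x‖ₑ ^ 2 ∂(densityMeasure ρ)) := by
        refine lintegral_mono fun x => ?_
        rw [e]
        exact enorm_integral_sq_le
          (hmeas.comp measurable_prodMk_left).aestronglyMeasurable
    _ = ∫⁻ y, (∫⁻ x in D, ‖f ((1 - t) • x + t • y) - f x‖ₑ ^ 2) ∂(densityMeasure ρ) :=
        lintegral_lintegral_swap (by
          exact (hmeas.enorm.pow_const 2).aemeasurable)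
    _ ≤ ∫⁻ _, ε ^ 2 ∂(densityMeasure ρ) := by
        refine lintegral_mono_ae ?_
        filter_upwards [ae_densityMeasure_mem hρ] with y hy
        rw [← eLpNorm_two_sq]
        gcongr
        exact h y hy
    _ = ε ^ 2 := by simp

/-- Replace `f` by a continuous compactly supported `g`. Dilations with ratio at least `1 / 2` have
uniformly bounded norm on `L²`, and `g` is uniformly continuous while points of `D` move by at most
`t` times a bound on its diameter. -/
lemma eventually_eLpNorm_dilate_sub_le (hDb : Bornology.IsBounded D) (hf : MemLp f 2 volume)
    {ε : ENNReal} (hε : 0 < ε) :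
    ∀ᶠ t : ℝ in 𝓝[>] 0, ∀ y ∈ D,
      eLpNorm (fun x => f ((1 - t) • x + t • y) - f x) 2 (volume.restrict D) ≤ ε := by
  -- `C` bounds the `L²` norm of composition with the dilation when `t < 1 / 2`. The three errors
  -- below total `C * δ + δ + δ`, which explains the choice of `δ`.
  set C : ENNReal := ENNReal.ofReal (2 ^ d) ^ (1 / (2 : ENNReal)).toReal with hC
  have hCtop : C ≠ ⊤ := (ENNReal.rpow_lt_top_of_nonneg (by positivity) (by simp)).ne
  set δ := ε / (C + 1 + 1) with hδ
  have hδ0 : δ ≠ 0 := (ENNReal.div_pos hε.ne' (by simp [hCtop])).ne'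
  obtain ⟨g, hgc, hgle, hgcont, hgm⟩ := hf.exists_hasCompactSupport_eLpNorm_sub_le (by norm_num) hδ0
  have huc := hgc.uniformContinuous_of_continuous hgcont
  have hDfin : (volume.restrict D) univ ^ ((2 : ENNReal).toReal)⁻¹ ≠ ⊤ := by
    refine (ENNReal.rpow_lt_top_of_nonneg (by positivity) ?_).ne
    simpa using hDb.measure_lt_top.ne
  -- A uniform bound `η` on the bounded set `D` then gives an `L²` bound `δ`.
  obtain ⟨η, hη, hηlt⟩ := ENNReal.exists_nnreal_pos_mul_lt hDfin hδ0
  obtain ⟨r, hr, hrη⟩ := Metric.uniformContinuous_iff.1 huc η (by exact_mod_cast hη)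
  obtain ⟨R, hR⟩ := Metric.isBounded_iff.1 hDb
  have hev : ∀ᶠ t : ℝ in 𝓝[>] 0, t < 1 / 2 ∧ t * (|R| + 1) < r := by
    refine nhdsWithin_le_nhds (Filter.Eventually.and (gt_mem_nhds (by norm_num)) ?_)
    have : Tendsto (fun t : ℝ => t * (|R| + 1)) (𝓝 0) (𝓝 (0 * (|R| + 1))) :=
      tendsto_id.mul_const _
    rw [zero_mul] at this
    exact this.eventually (gt_mem_nhds hr)
  filter_upwards [hev, self_mem_nhdsWithin] with t ht ht0 y hy
  rw [mem_Ioi] at ht0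
  have hc : (1 - t) ≠ 0 := by linarith [ht.1]
  have hle : volume.restrict D ≤ (volume : Measure (Euc d)) := Measure.restrict_le_self
  have m1 := (memLp_comp_affine hc (t • y) hf).1
  have m2 := (memLp_comp_affine hc (t • y) hgm).1
  have hsplit : (fun x => f ((1 - t) • x + t • y) - f x) =
      ((fun x => (f - g) ((1 - t) • x + t • y)) + fun x => g ((1 - t) • x + t • y) - g x) +
        fun x => g x - f x := by
    ext x; simp
  have b1 : eLpNorm (fun x => (f - g) ((1 - t) • x + t • y)) 2 (volume.restrict D) ≤ C * δ := by
    refine (eLpNorm_mono_measure _ hle).trans ?_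
    rw [eLpNorm_comp_affine hc (t • y) (hf.1.sub hgm.1)]
    gcongr
    rw [hC]
    gcongr
    rw [abs_inv, inv_eq_one_div, div_le_iff₀ (by positivity), abs_pow, ← mul_pow]
    refine one_le_pow₀ ?_
    rw [abs_of_pos (by linarith [ht.1])]
    linarith [ht.1]
  have b2 : eLpNorm (fun x => g ((1 - t) • x + t • y) - g x) 2 (volume.restrict D) ≤ δ := by
    refine (eLpNorm_le_of_ae_bound (C := η) ?_).trans ?_
    · refine ae_restrict_of_ae_restrict_of_subset (t := closure D) subset_closure ?_
      refine (ae_restrict_iff' isClosed_closure.measurableSet).2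
        (Eventually.of_forall fun x hx => ?_)
      rw [← dist_eq_norm]
      refine (hrη ?_).le
      have e1 : (1 - t) • x + t • y - x = t • (y - x) := by
        simp only [sub_smul, smul_sub, one_smul]; abel
      have hdist : dist y x ≤ |R| := by
        have hcl : closure D ⊆ {x | dist y x ≤ |R|} :=
          closure_minimal (fun z hz => (hR hy hz).trans (le_abs_self R))
            (isClosed_le (by fun_prop) continuous_const)
        exact hcl hx
      rw [dist_eq_norm, e1, norm_smul, Real.norm_eq_abs, abs_of_pos ht0, ← dist_eq_norm]
      refine lt_of_le_of_lt ?_ ht.2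
      gcongr
      linarith
    · rw [mul_comm, ENNReal.ofReal_coe_nnreal]
      exact hηlt.le
  have b3 : eLpNorm (fun x => g x - f x) 2 (volume.restrict D) ≤ δ := by
    refine (eLpNorm_mono_measure _ hle).trans ?_
    have : (fun x => g x - f x) = -(f - g) := by ext x; simp
    rw [this, eLpNorm_neg]
    exact hgle
  rw [hsplit]
  have m3 : AEStronglyMeasurable (fun x => (f - g) ((1 - t) • x + t • y)) volume := m1.sub m2
  have m4 : AEStronglyMeasurable (fun x => g ((1 - t) • x + t • y) - g x) volume := m2.sub hgm.1
  refine (eLpNorm_add_le ((m3.add m4).mono_measure hle) ((hgm.1.sub hf.1).mono_measure hle)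
    (by norm_num)).trans ?_
  refine (add_le_add (eLpNorm_add_le (m3.mono_measure hle) (m4.mono_measure hle)
    (by norm_num)) le_rfl).trans ?_
  calc _ ≤ C * δ + δ + δ := add_le_add (add_le_add b1 b2) b3
    _ = (C + 1 + 1) * δ := by ring
    _ ≤ ε := ENNReal.mul_div_le

lemma smear_congr (ht : 0 < t) (h : f =ᵐ[volume] g) : smear ρ t f = smear ρ t g := by
  ext x
  rw [smear_eq_integral ht, smear_eq_integral ht]
  refine integral_congr_ae ?_
  filter_upwards [h] with z hz
  rw [hz]

lemma tendsto_eLpNorm_smear (hDb : Bornology.IsBounded D) (hρ : IsSmoothDensity D ρ)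
    (hf : MemLp f 2 volume) :
    Tendsto (fun t => eLpNorm (fun x => smear ρ t f x - f x) 2 (volume.restrict D))
      (𝓝[>] 0) (𝓝 0) := by
  rw [ENNReal.tendsto_nhds_zero]
  intro ε hε
  have hae := hf.1.ae_eq_mk
  have hmk : MemLp (hf.1.mk f) 2 volume := hf.ae_eq hae
  filter_upwards [eventually_eLpNorm_dilate_sub_le hDb hmk hε, self_mem_nhdsWithin] with t ht ht0
  have := eLpNorm_smear_sub_le hρ ht0 hf.1.stronglyMeasurable_mk hmk ht
  rw [smear_congr ht0 hae]
  refine le_trans (le_of_eq (eLpNorm_congr_ae ?_)) this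
  filter_upwards [ae_restrict_of_ae hae] with x hx
  rw [hx]

lemma tendsto_eLpNorm_smear_sub (hD : IsOpen D) (hDb : Bornology.IsBounded D)
    (hρ : IsSmoothDensity D ρ) (hv : MemL2 D v) :
    Tendsto (fun t => eLpNorm (fun x => smear ρ t (D.indicator v) x - v x) 2 (volume.restrict D))
      (𝓝[>] 0) (𝓝 0) := by
  refine (tendsto_eLpNorm_smear hDb hρ
    ((memLp_indicator_iff_restrict hD.measurableSet).2 hv)).congr fun t => eLpNorm_congr_ae ?_
  filter_upwards [ae_restrict_mem hD.measurableSet] with x hx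
  simp [hx]

lemma eLpNorm_partialDeriv_smear_sub_le (hD : IsOpen D) (hconv : Convex ℝ D) (ht : 0 < t)
    (ht1 : t < 1) (hρ : IsSmoothDensity D ρ) {i : Fin d} (hv : MemL2 D v)
    (hg : IsWeakPartial D i v g) :
    eLpNorm (fun x => partialDeriv i (smear ρ t (D.indicator v)) x - g x) 2 (volume.restrict D) ≤
      eLpNorm (fun x => smear ρ t (D.indicator g) x - g x) 2 (volume.restrict D) +
        ENNReal.ofReal t * eLpNorm g 2 (volume.restrict D) := by
  -- The chain-rule factor is split off: `(1 - t) * S - g = (1 - t) * (S - g) - t * g`, where `S` is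
  -- the smeared `g`.
  have e : (fun x => partialDeriv i (smear ρ t (D.indicator v)) x - g x)
      =ᵐ[volume.restrict D]
      ((1 - t) • fun x => smear ρ t (D.indicator g) x - g x) - t • g := by
    filter_upwards [ae_restrict_mem hD.measurableSet] with x hx
    rw [partialDeriv_smear hD hconv ht ht1 hρ hv hg hx]
    simp only [Pi.sub_apply, Pi.smul_apply, smul_eq_mul]
    ring
  have hmS : AEStronglyMeasurable (fun x => smear ρ t (D.indicator g) x - g x)
      (volume.restrict D) :=
    (contDiff_smear ht hρ (locallyIntegrable_indicator hD hg.1)).continuous.aestronglyMeasurable.sub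
      hg.1.1
  refine (eLpNorm_congr_ae e).le.trans ?_
  refine (eLpNorm_sub_le (hmS.const_smul _) (hg.1.1.const_smul _) (by norm_num)).trans ?_
  rw [eLpNorm_const_smul, eLpNorm_const_smul]
  refine add_le_add ?_ ?_
  · refine mul_le_of_le_one_left bot_le ?_
    rw [Real.enorm_eq_ofReal (by linarith)]
    exact ENNReal.ofReal_le_one.2 (by linarith)
  · rw [Real.enorm_eq_ofReal ht.le]

lemma tendsto_eLpNorm_partialDeriv_smear_sub (hD : IsOpen D) (hDb : Bornology.IsBounded D)
    (hconv : Convex ℝ D) (hρ : IsSmoothDensity D ρ) {i : Fin d} (hv : MemL2 D v)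
    (hg : IsWeakPartial D i v g) :
    Tendsto (fun t => eLpNorm (fun x => partialDeriv i (smear ρ t (D.indicator v)) x - g x) 2
      (volume.restrict D)) (𝓝[>] 0) (𝓝 0) := by
  have h0 : Tendsto (fun t : ℝ => ENNReal.ofReal t * eLpNorm g 2 (volume.restrict D)) (𝓝[>] 0)
      (𝓝 (ENNReal.ofReal 0 * eLpNorm g 2 (volume.restrict D))) :=
    ENNReal.Tendsto.mul_const (ENNReal.tendsto_ofReal (tendsto_id.mono_left nhdsWithin_le_nhds))
      (Or.inr hg.1.2.ne)
  have hT := (tendsto_eLpNorm_smear_sub hD hDb hρ hg.1).add h0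
  rw [ENNReal.ofReal_zero, zero_mul, add_zero] at hT
  have hlt : ∀ᶠ t : ℝ in 𝓝[>] 0, t < 1 := nhdsWithin_le_nhds (gt_mem_nhds one_pos)
  refine tendsto_of_tendsto_of_tendsto_of_le_of_le' tendsto_const_nhds hT
    (Eventually.of_forall fun _ => bot_le) ?_
  filter_upwards [hlt, self_mem_nhdsWithin] with t ht1 ht
  exact eLpNorm_partialDeriv_smear_sub_le hD hconv ht ht1 hρ hv hg

/-- Smooth functions are dense in `H¹(D)` for a bounded convex open set `D`. -/
lemma exists_tendstoH1 (hD : IsOpen D) (hne : D.Nonempty) (hDb : Bornology.IsBounded D)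
    (hconv : Convex ℝ D) (hv : MemH1 D v) : ∃ ψ, TendstoH1 D ψ v := by
  obtain ⟨ρ, hρ⟩ := exists_isSmoothDensity hD hne
  obtain ⟨t, ht, ht0⟩ : ∃ t : ℕ → ℝ, Tendsto t atTop (𝓝[>] 0) ∧ ∀ n, 0 < t n := by
    refine ⟨fun n => 1 / ((n : ℝ) + 1), tendsto_nhdsWithin_iff.2
      ⟨tendsto_one_div_add_atTop_nhds_zero_nat, Eventually.of_forall fun n => ?_⟩, fun n => ?_⟩
    · rw [mem_Ioi]; positivity
    · positivity
  exact ⟨fun n => smear ρ (t n) (D.indicator v),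
    fun n => contDiff_smear (ht0 n) hρ (locallyIntegrable_indicator hD hv.1),
    (tendsto_eLpNorm_smear_sub hD hDb hρ hv.1).comp ht,
    fun i => (tendsto_eLpNorm_partialDeriv_smear_sub hD hDb hconv hρ hv.1
      (isWeakPartial_weakPartial hv i)).comp ht⟩

end Density

/-! ### Traces on the faces of a simplex -/

section SimplexTrace

variable {ι : Type*} [Fintype ι] (b : AffineBasis ι ℝ (Euc d))

lemma convex_simplexBody : Convex ℝ (simplexBody b) := by
  rw [simplexBody_eq_convexHull]; exact convex_convexHull ℝ _

lemma restrict_interior_simplexBody :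
    (volume : Measure (Euc d)).restrict (interior (simplexBody b)) =
      volume.restrict (simplexBody b) :=
  Measure.restrict_congr_set (interior_ae_eq_of_null_frontier
    ((convex_simplexBody b).addHaar_frontier volume))

lemma nonempty_interior_simplexBody : (interior (simplexBody b)).Nonempty := by
  rw [simplexBody_eq_convexHull]
  exact ⟨_, b.centroid_mem_interior_convexHull⟩

lemma isBounded_interior_simplexBody : Bornology.IsBounded (interior (simplexBody b)) :=
  (isCompact_simplexBody b).isBounded.subset interior_subset

lemma exists_tendstoH1_simplex {v : Euc d → ℝ} (hv : MemH1 (interior (simplexBody b)) v) :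
    ∃ ψ, TendstoH1 (interior (simplexBody b)) ψ v :=
  exists_tendstoH1 isOpen_interior (nonempty_interior_simplexBody b)
    (isBounded_interior_simplexBody b) (convex_simplexBody b).interior hv

lemma fderiv_eq_sum_partialDeriv (ψ : Euc d → ℝ) (x y : Euc d) :
    fderiv ℝ ψ x y = ∑ i, y i * partialDeriv i ψ x := by
  conv_lhs => rw [← (EuclideanSpace.basisFun (Fin d) ℝ).sum_repr y]
  simp [partialDeriv]

/-- Apply the radial divergence identity to `ψ ^ 2`, and bound the cross term `2 * ψ * ∂ψ` by
Young's inequality. -/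
lemma exists_integral_simplexFace_sq_le (hd : d ≠ 0) [Nontrivial ι] (i : ι) :
    ∃ C : ℝ, ∀ ψ : Euc d → ℝ, ContDiff ℝ ∞ ψ →
      ∫ x in simplexFace b i, ψ x ^ 2 ∂(surf d) ≤
        C * ∫ x in simplexBody b, (ψ x ^ 2 + ∑ j, partialDeriv j ψ x ^ 2) := by
  obtain ⟨M, hM⟩ := (isCompact_simplexBody b).isBounded.subset_closedBall (b i)
  have hh : 0 < ‖altitude b i‖ := norm_pos_iff.2 (altitude_ne_zero b i)
  -- The integrand is at most `(d + 1) * ψ ^ 2 + M ^ 2 * |∇ψ| ^ 2`, where `M` bounds the distance to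
  -- the vertex; `d + 1 + M ^ 2` dominates both coefficients.
  refine ⟨‖altitude b i‖⁻¹ * (d + 1 + M ^ 2), fun ψ hψ => ?_⟩
  have hψ1 : ContDiff ℝ 1 fun x => ψ x ^ 2 := (hψ.pow 2).of_le (by simp)
  rw [mul_assoc, ← div_eq_inv_mul, le_div_iff₀' hh, ← integral_simplexBody_cone b hd i hψ1,
    ← integral_const_mul]
  have hc := hψ.continuous
  have hcp := fun j => continuous_partialDeriv hψ j
  refine setIntegral_mono_on ?_ ?_ (isClosed_simplexBody b).measurableSet fun x hx => ?_
  · refine ContinuousOn.integrableOn_compact (isCompact_simplexBody b) (Continuous.continuousOn ?_)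
    have := hψ1.continuous_fderiv one_ne_zero
    fun_prop
  · refine ContinuousOn.integrableOn_compact (isCompact_simplexBody b) (Continuous.continuousOn ?_)
    fun_prop
  · have h1 : fderiv ℝ (fun x => ψ x ^ 2) x (x - b i) = 2 * ψ x * fderiv ℝ ψ x (x - b i) := by
      rw [fderiv_fun_pow 2 (hψ.differentiable (by simp) x)]
      simp
    have h2 : (fderiv ℝ ψ x (x - b i)) ^ 2 ≤ M ^ 2 * ∑ j, partialDeriv j ψ x ^ 2 := by
      rw [fderiv_eq_sum_partialDeriv]
      refine (Finset.sum_mul_sq_le_sq_mul_sq _ _ _).trans ?_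
      gcongr
      have h3 : ‖x - b i‖ ≤ M := by
        have := hM hx
        rwa [Metric.mem_closedBall, dist_eq_norm] at this
      calc ∑ j, (x - b i) j ^ 2 = ‖x - b i‖ ^ 2 := by
            rw [EuclideanSpace.norm_sq_eq]; simp
        _ ≤ M ^ 2 := by gcongr
    have h4 : 0 ≤ ∑ j, partialDeriv j ψ x ^ 2 := Finset.sum_nonneg fun j _ => sq_nonneg _
    rw [h1]
    nlinarith [sq_nonneg (ψ x - fderiv ℝ ψ x (x - b i)), sq_nonneg M, sq_nonneg (ψ x),
      mul_nonneg (Nat.cast_nonneg (α := ℝ) d) h4, mul_nonneg (sq_nonneg M) (sq_nonneg (ψ x))]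

lemma eLpNorm_two_sq_eq_ofReal {α : Type*} [MeasurableSpace α] {μ : Measure α} {f : α → ℝ}
    (hf : MemLp f 2 μ) : eLpNorm f 2 μ ^ 2 = ENNReal.ofReal (∫ x, f x ^ 2 ∂μ) := by
  rw [eLpNorm_two_sq, ofReal_integral_eq_lintegral_ofReal hf.integrable_sq
    (Eventually.of_forall fun x => sq_nonneg _)]
  refine lintegral_congr fun x => ?_
  rw [Real.enorm_eq_ofReal_abs, ← ENNReal.ofReal_pow (abs_nonneg _), sq_abs]

/-- The trace inequality on a simplex. -/
lemma exists_eLpNorm_simplexFace_le (hd : d ≠ 0) [Nontrivial ι] (i : ι) :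
    ∃ C : ENNReal, C ≠ ⊤ ∧ ∀ ψ : Euc d → ℝ, ContDiff ℝ ∞ ψ →
      eLpNorm ψ 2 ((surf d).restrict (simplexFace b i)) ^ 2 ≤
        C * (eLpNorm ψ 2 (volume.restrict (interior (simplexBody b))) ^ 2 +
          ∑ j, eLpNorm (partialDeriv j ψ) 2
            (volume.restrict (interior (simplexBody b))) ^ 2) := by
  obtain ⟨C, hC⟩ := exists_integral_simplexFace_sq_le b hd i
  refine ⟨ENNReal.ofReal C, by simp, fun ψ hψ => ?_⟩
  have := isFiniteMeasure_restrict_volume (isCompact_simplexBody b).isBounded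
  have hb := (isCompact_simplexBody b).isBounded
  have m1 : MemLp ψ 2 (volume.restrict (simplexBody b)) :=
    memLp_of_continuous_of_isBounded hb hψ.continuous
  have m2 : ∀ j, MemLp (partialDeriv j ψ) 2 (volume.restrict (simplexBody b)) := fun j =>
    memLp_of_continuous_of_isBounded hb (continuous_partialDeriv hψ j)
  have m3 : MemLp ψ 2 ((surf d).restrict (simplexFace b i)) :=
    memLp_of_continuous_of_isBounded (isCompact_simplexFace b i).isBounded hψ.continuous
  rw [restrict_interior_simplexBody, eLpNorm_two_sq_eq_ofReal m1, eLpNorm_two_sq_eq_ofReal m3]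
  simp_rw [fun j => eLpNorm_two_sq_eq_ofReal (m2 j)]
  rw [← ENNReal.ofReal_sum_of_nonneg (fun j _ => integral_nonneg fun x => sq_nonneg _),
    ← ENNReal.ofReal_add (integral_nonneg fun x => sq_nonneg _)
      (Finset.sum_nonneg fun j _ => integral_nonneg fun x => sq_nonneg _),
    ← integral_finsetSum _ fun j _ => (m2 j).integrable_sq,
    ← integral_add m1.integrable_sq (integrable_finsetSum _ fun j _ => (m2 j).integrable_sq),
    ← ENNReal.ofReal_mul' (integral_nonneg fun x => by positivity)]
  exact ENNReal.ofReal_le_ofReal (hC ψ hψ)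

lemma tendsto_sq_zero_iff {κ : Type*} {l : Filter κ} {f : κ → ENNReal} :
    Tendsto (fun x => f x ^ 2) l (𝓝 0) ↔ Tendsto f l (𝓝 0) := by
  constructor
  · intro h
    have h1 := ((ENNReal.continuous_rpow_const (y := 1 / 2)).tendsto 0).comp h
    rw [ENNReal.zero_rpow_of_pos (by norm_num)] at h1
    refine h1.congr fun x => ?_
    rw [Function.comp_apply, ← ENNReal.rpow_natCast, ← ENNReal.rpow_mul]
    simp
  · intro h
    have h1 := ((ENNReal.continuous_pow 2).tendsto 0).comp h
    simpa [Function.comp_def] using h1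

lemma tendsto_eLpNorm_simplexFace (hd : d ≠ 0) [Nontrivial ι] (i : ι) {κ : Type*} {l : Filter κ}
    {ψ : κ → Euc d → ℝ} (hψ : ∀ n, ContDiff ℝ ∞ (ψ n))
    (h0 : Tendsto (fun n => eLpNorm (ψ n) 2 (volume.restrict (interior (simplexBody b)))) l (𝓝 0))
    (h1 : ∀ j, Tendsto (fun n => eLpNorm (partialDeriv j (ψ n)) 2
      (volume.restrict (interior (simplexBody b)))) l (𝓝 0)) :
    Tendsto (fun n => eLpNorm (ψ n) 2 ((surf d).restrict (simplexFace b i))) l (𝓝 0) := by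
  obtain ⟨C, hC, h⟩ := exists_eLpNorm_simplexFace_le b hd i
  rw [← tendsto_sq_zero_iff]
  have h2 : Tendsto (fun n => C * (eLpNorm (ψ n) 2
      (volume.restrict (interior (simplexBody b))) ^ 2 + ∑ j, eLpNorm (partialDeriv j (ψ n)) 2
        (volume.restrict (interior (simplexBody b))) ^ 2)) l
      (𝓝 (C * (0 + ∑ _j : Fin d, 0))) :=
    ENNReal.Tendsto.const_mul ((tendsto_sq_zero_iff.2 h0).add
      (tendsto_finsetSum _ fun j _ => tendsto_sq_zero_iff.2 (h1 j))) (Or.inr hC)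
  simp only [Finset.sum_const_zero, add_zero, mul_zero] at h2
  exact tendsto_of_tendsto_of_tendsto_of_le_of_le tendsto_const_nhds h2 (fun _ => bot_le)
    fun n => h _ (hψ n)

lemma partialDeriv_sub {f g : Euc d → ℝ} (hf : ContDiff ℝ ∞ f) (hg : ContDiff ℝ ∞ g) (i : Fin d) :
    partialDeriv i (fun x => f x - g x) = fun x => partialDeriv i f x - partialDeriv i g x := by
  ext x
  simp [partialDeriv, fderiv_fun_sub (hf.differentiable (by simp) x)
    (hg.differentiable (by simp) x)]

variable {v w g g' : Euc d → ℝ}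

/-- Functions in `H¹` of a simplex have traces on its faces. -/
lemma exists_hasTrace_simplexFace (hd : d ≠ 0) [Nontrivial ι] (i : ι)
    (hv : MemH1 (interior (simplexBody b)) v) :
    ∃ g, HasTrace (interior (simplexBody b)) (simplexFace b i) v g := by
  obtain ⟨ψ, hψ⟩ := exists_tendstoH1_simplex b hv
  have hcp := fun n j => (continuous_partialDeriv (hψ.smooth n) j)
  have hmF : ∀ n, MemLp (ψ n) 2 ((surf d).restrict (simplexFace b i)) := fun n =>
    memLp_of_continuous_of_isBounded (isCompact_simplexFace b i).isBounded
      (hψ.smooth n).continuous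
  have c0 := L2_cauchy_of_tendsto (fun n => (hψ.smooth n).continuous.aestronglyMeasurable) hv.1.1
    hψ.val
  have c1 : ∀ j, Tendsto (fun p : ℕ × ℕ => eLpNorm (partialDeriv j fun x => ψ p.1 x - ψ p.2 x) 2
      (volume.restrict (interior (simplexBody b)))) atTop (𝓝 0) := by
    intro j
    refine (L2_cauchy_of_tendsto (f := fun n => partialDeriv j (ψ n))
      (fun n => (hcp n j).aestronglyMeasurable) (hv.memL2_weakPartial j).1 (hψ.grad j)).congr
      fun p => ?_
    rw [partialDeriv_sub (hψ.smooth p.1) (hψ.smooth p.2) j]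
  obtain ⟨g, hg, hgl⟩ := exists_L2_limit hmF (tendsto_eLpNorm_simplexFace b hd i
    (fun p : ℕ × ℕ => (hψ.smooth p.1).sub (hψ.smooth p.2)) c0 c1)
  exact ⟨g, hasTrace_iff.2 ⟨hv, hg, ψ, hψ, hgl⟩⟩

/-- The trace does not depend on the approximating sequence: the difference of two such sequences
tends to zero in `H¹`, hence on the face by the trace inequality. -/
lemma HasTrace.tendsto_of_tendstoH1 (hd : d ≠ 0) [Nontrivial ι] {i : ι}
    (h : HasTrace (interior (simplexBody b)) (simplexFace b i) v g) {ψ : ℕ → Euc d → ℝ}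
    (hψ : TendstoH1 (interior (simplexBody b)) ψ v) :
    Tendsto (fun n => eLpNorm (fun x => ψ n x - g x) 2 ((surf d).restrict (simplexFace b i)))
      atTop (𝓝 0) := by
  obtain ⟨hv, hg, χ, hχ, hχg⟩ := hasTrace_iff.1 h
  have h1 := tendsto_eLpNorm_simplexFace b hd i (l := atTop) (ψ := fun n x => ψ n x - χ n x)
    (fun n => (hψ.smooth n).sub (hχ.smooth n)) ?_ fun j => ?_
  · refine tendsto_of_tendsto_of_tendsto_of_le_of_le tendsto_const_nhds
      (by simpa using h1.add hχg) (fun _ => bot_le) fun n => ?_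
    have : (fun x => ψ n x - g x) = (fun x => ψ n x - χ n x) + fun x => χ n x - g x := by
      ext x; simp
    rw [this]
    exact eLpNorm_add_le ((hψ.smooth n).sub (hχ.smooth n)).continuous.aestronglyMeasurable
      ((hχ.smooth n).continuous.aestronglyMeasurable.sub hg.1) (by norm_num)
  · have := L2_tendsto_sub (fun n => (hψ.smooth n).continuous.aestronglyMeasurable)
      (fun n => (hχ.smooth n).continuous.aestronglyMeasurable) hv.1.1 hv.1.1 hψ.val hχ.val
    simpa using this
  · simp_rw [fun n => partialDeriv_sub (hψ.smooth n) (hχ.smooth n) j]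
    have := L2_tendsto_sub
      (fun n => (continuous_partialDeriv (hψ.smooth n) j).aestronglyMeasurable)
      (fun n => (continuous_partialDeriv (hχ.smooth n) j).aestronglyMeasurable)
      (hv.memL2_weakPartial j).1 (hv.memL2_weakPartial j).1 (hψ.grad j) (hχ.grad j)
    simpa using this

lemma HasTrace.ae_unique (hd : d ≠ 0) [Nontrivial ι] {i : ι}
    (h : HasTrace (interior (simplexBody b)) (simplexFace b i) v g)
    (h' : HasTrace (interior (simplexBody b)) (simplexFace b i) v g') :
    g =ᵐ[(surf d).restrict (simplexFace b i)] g' := by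
  obtain ⟨hv, hg, ψ, hψ, hψg⟩ := hasTrace_iff.1 h
  exact L2_limit_ae_unique (fun n => (hψ.smooth n).continuous.aestronglyMeasurable) hg h'.2.1 hψg
    (h'.tendsto_of_tendstoH1 b hd hψ)

/-- Integration by parts on a simplex. -/
lemma integral_simplexBody_by_parts (hd : d ≠ 0) [Nontrivial ι] {gv gw : ι → Euc d → ℝ}
    (hv : MemH1 (interior (simplexBody b)) v) (hw : MemH1 (interior (simplexBody b)) w)
    (hgv : ∀ i, HasTrace (interior (simplexBody b)) (simplexFace b i) v (gv i))
    (hgw : ∀ i, HasTrace (interior (simplexBody b)) (simplexFace b i) w (gw i)) (k : Fin d) :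
    (∫ x in interior (simplexBody b), v x * weakPartial (interior (simplexBody b)) k w x) +
        (∫ x in interior (simplexBody b), w x * weakPartial (interior (simplexBody b)) k v x) =
      ∑ i, faceNormal b i k * ∫ x in simplexFace b i, gv i x * gw i x ∂(surf d) := by
  obtain ⟨ψ, hψ⟩ := exists_tendstoH1_simplex b hv
  obtain ⟨χ, hχ⟩ := exists_tendstoH1_simplex b hw
  have hbd := isBounded_interior_simplexBody b
  have := isFiniteMeasure_restrict_volume hbd
  have hm : ∀ {f : Euc d → ℝ}, Continuous f →
      MemLp f 2 (volume.restrict (interior (simplexBody b))) :=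
    fun hf => memLp_of_continuous_of_isBounded hbd hf
  have hmF : ∀ {f : Euc d → ℝ}, Continuous f → ∀ i,
      MemLp f 2 ((surf d).restrict (simplexFace b i)) :=
    fun hf i => memLp_of_continuous_of_isBounded (isCompact_simplexFace b i).isBounded hf
  have hψc := fun n => (hψ.smooth n).continuous
  have hχc := fun n => (hχ.smooth n).continuous
  have hψp := fun n => continuous_partialDeriv (hψ.smooth n) k
  have hχp := fun n => continuous_partialDeriv (hχ.smooth n) k
  have L := (tendsto_integral_mul_of_L2 (fun n => hm (hψc n)) (fun n => hm (hχp n)) hv.1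
    (hw.memL2_weakPartial k) hψ.val (hχ.grad k)).add
    (tendsto_integral_mul_of_L2 (fun n => hm (hχc n)) (fun n => hm (hψp n)) hw.1
    (hv.memL2_weakPartial k) hχ.val (hψ.grad k))
  have R := tendsto_finsetSum Finset.univ fun i _ =>
    (tendsto_integral_mul_of_L2 (fun n => hmF (hψc n) i) (fun n => hmF (hχc n) i) (hgv i).2.1
    (hgw i).2.1 ((hgv i).tendsto_of_tendstoH1 b hd hψ)
    ((hgw i).tendsto_of_tendstoH1 b hd hχ)).const_mul (faceNormal b i k)
  refine tendsto_nhds_unique (L.congr fun n => ?_) R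
  -- For smooth approximations the claim is the divergence theorem applied to the product; every
  -- term passes to the limit by `L²` convergence.
  have key := integral_simplexBody_fderiv b hd
    (((hψ.smooth n).mul (hχ.smooth n)).of_le (m := 1) (by simp)) (EuclideanSpace.single k (1 : ℝ))
  rw [restrict_interior_simplexBody, ← integral_add]
  · convert key using 2 with i
    · ext x
      exact (partialDeriv_mul (hψ.smooth n) (hχ.smooth n) k x).symm
    · simp [EuclideanSpace.inner_single_right]
  · rw [← restrict_interior_simplexBody]; exact (hm (hψc n)).integrable_mul (hm (hχp n))
  · rw [← restrict_interior_simplexBody]; exact (hm (hχc n)).integrable_mul (hm (hψp n))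

end SimplexTrace

/-! ### Geometry of a triangulation near generic points of its facets -/

/-- A point of a face of a simplex which lies on no other face. -/
def IsFacePoint {ι : Type*} (b : AffineBasis ι ℝ (Euc d)) (i : ι) (x : Euc d) : Prop :=
  b.coord i x = 0 ∧ ∀ j, j ≠ i → 0 < b.coord j x

/-! ### Shape of a simplex near a generic point of a face -/

section LocalSimplex

variable {ι : Type*} [Fintype ι] {b : AffineBasis ι ℝ (Euc d)} {i : ι} {x : Euc d}

lemma IsFacePoint.mem_simplexFace (h : IsFacePoint b i x) : x ∈ simplexFace b i := by
  refine ⟨fun j => ?_, h.1⟩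
  by_cases hj : j = i
  · rw [hj, h.1]
  · exact (h.2 j hj).le

lemma IsFacePoint.eventually_pos (h : IsFacePoint b i x) :
    ∀ᶠ y in 𝓝 x, ∀ j, j ≠ i → 0 < b.coord j y := by
  refine eventually_all.2 fun j => ?_
  by_cases hj : j = i
  · exact Eventually.of_forall fun y h' => absurd hj h'
  · filter_upwards [(continuous_coord b j).continuousAt.eventually (lt_mem_nhds (h.2 j hj))]
      with y hy _ using hy

lemma IsFacePoint.eventually_mem_body (h : IsFacePoint b i x) :
    ∀ᶠ y in 𝓝 x, y ∈ simplexBody b ↔ 0 ≤ b.coord i y := by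
  filter_upwards [h.eventually_pos] with y hy
  refine ⟨fun h' => h' i, fun h' j => ?_⟩
  by_cases hj : j = i
  · rwa [hj]
  · exact (hy j hj).le

lemma IsFacePoint.eventually_mem_interior (h : IsFacePoint b i x) :
    ∀ᶠ y in 𝓝 x, y ∈ interior (simplexBody b) ↔ 0 < b.coord i y := by
  filter_upwards [h.eventually_pos] with y hy
  rw [interior_simplexBody]
  refine ⟨fun h' => h' i, fun h' j => ?_⟩
  by_cases hj : j = i
  · rwa [hj]
  · exact hy j hj

lemma norm_faceNormal [Nontrivial ι] (i : ι) : ‖faceNormal b i‖ = 1 := by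
  rw [faceNormal, norm_neg, norm_smul, norm_inv, norm_norm,
    inv_mul_cancel₀ (by simpa using coordGrad_ne_zero b i)]

lemma coordGrad_eq_smul_faceNormal [Nontrivial ι] (i : ι) :
    coordGrad b i = -(‖coordGrad b i‖ • faceNormal b i) := by
  rw [faceNormal, smul_neg, neg_neg, smul_smul,
    mul_inv_cancel₀ (by simpa using coordGrad_ne_zero b i), one_smul]

/-- Arbitrarily close to any point the coordinate function takes smaller values. -/
lemma exists_coord_lt [Nontrivial ι] (b : AffineBasis ι ℝ (Euc d)) (i : ι) (y : Euc d)
    {U : Set (Euc d)} (hU : U ∈ 𝓝 y) (σ : ℝ) (hσ : σ ≠ 0) :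
    ∃ z ∈ U, 0 < σ * (b.coord i z - b.coord i y) := by
  have hc : Tendsto (fun τ : ℝ => y + τ • (σ • coordGrad b i)) (𝓝[>] 0) (𝓝 y) := by
    have : Continuous fun τ : ℝ => y + τ • (σ • coordGrad b i) := by fun_prop
    have := this.tendsto 0
    simp only [zero_smul, add_zero] at this
    exact this.mono_left nhdsWithin_le_nhds
  obtain ⟨τ, hτ, hτ0⟩ := ((hc.eventually hU).and self_mem_nhdsWithin).exists
  refine ⟨_, hτ, ?_⟩
  rw [coord_add, inner_smul_right, inner_smul_right, real_inner_self_eq_norm_sq]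
  have hg : 0 < ‖coordGrad b i‖ := norm_pos_iff.2 (coordGrad_ne_zero b i)
  have hτ0' : (0 : ℝ) < τ := hτ0
  have hσ2 : 0 < σ ^ 2 := by positivity
  have : σ * (b.coord i y + τ * (σ * ‖coordGrad b i‖ ^ 2) - b.coord i y) =
    τ * σ ^ 2 * ‖coordGrad b i‖ ^ 2 := by ring
  rw [this]; positivity

end LocalSimplex

/-! ### Elements meeting at a facet, and the outer normal -/

section Triangulation

variable {Ω : Set (Euc d)} (T : Triangulation Ω)

/-- The affine basis formed by the vertices of an element. -/
def Triangulation.basis (s : T.elements) : AffineBasis s.1 ℝ (Euc d) where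
  toFun := Subtype.val
  ind' := T.complex.indep s.2.1
  tot' := by
    refine (T.complex.indep s.2.1).affineSpan_eq_top_iff_card_eq_finrank_add_one.2 ?_
    rw [Fintype.card_coe, s.2.2, finrank_euclideanSpace, Fintype.card_fin]

instance nontrivial_element [NeZero d] (s : T.elements) : Nontrivial s.1 := by
  rw [← Fintype.one_lt_card_iff_nontrivial, Fintype.card_coe, s.2.2]
  have := NeZero.pos d
  omega

instance finite_elements : Finite T.elements :=
  T.finite.subset fun _ h => h.1

@[simp] lemma basis_apply (s : T.elements) (p : s.1) : T.basis s p = p := rfl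

lemma simplexBody_basis (s : T.elements) :
    simplexBody (T.basis s) = convexHull ℝ (s.1 : Set (Euc d)) := by
  rw [simplexBody_eq_convexHull]
  congr 1
  exact Subtype.range_coe

lemma coord_vertex (s : T.elements) (p q : s.1) :
    (T.basis s).coord p (q : Euc d) = if p = q then 1 else 0 :=
  (T.basis s).coord_apply p q

/-- The coordinate is affine and vanishes at every vertex other than `p`. Combined with
`inter_subset_convexHull`, this expresses conformity in barycentric coordinates. -/
lemma coord_eq_zero_of_mem_convexHull (s : T.elements) (p : s.1) {A : Set (Euc d)}
    (hA : A ⊆ (s.1 : Set (Euc d))) (hp : (p : Euc d) ∉ A) {x : Euc d} (hx : x ∈ convexHull ℝ A) :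
    (T.basis s).coord p x = 0 := by
  have hconv : Convex ℝ ((T.basis s).coord p ⁻¹' {0}) := (convex_singleton 0).affine_preimage _
  refine convexHull_min (fun q hq => ?_) hconv hx
  have := coord_vertex T s p ⟨q, hA hq⟩
  rw [if_neg] at this
  · exact this
  · rintro rfl; exact hp hq

lemma simplexFace_basis (s : T.elements) (p : s.1) :
    simplexFace (T.basis s) p = convexHull ℝ ((s.1 : Set (Euc d)) \ {(p : Euc d)}) := by
  ext x
  constructor
  · rintro ⟨hx, h0⟩
    have hsum := (T.basis s).linear_combination_coord_eq_self x
    have h1 := (T.basis s).sum_coord_apply_eq_one x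
    rw [← Finset.sum_erase (a := p) _ (by rw [h0, zero_smul])] at hsum
    rw [← Finset.sum_erase (a := p) _ h0] at h1
    rw [← hsum]
    refine (convex_convexHull ℝ _).sum_mem (fun q _ => hx q) h1 fun q hq => ?_
    refine subset_convexHull ℝ _ ⟨q.2, ?_⟩
    rw [mem_singleton_iff]
    exact fun h => (Finset.mem_erase.1 hq).1 (Subtype.ext h)
  · intro hx
    refine ⟨?_, coord_eq_zero_of_mem_convexHull T s p sdiff_subset (by simp) hx⟩
    rw [simplexBody_basis]
    exact convexHull_mono sdiff_subset hx

lemma closure_eq_iUnion : closure Ω = ⋃ s : T.elements, simplexBody (T.basis s) := by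
  rw [← T.space_eq]
  ext x
  rw [Geometry.SimplicialComplex.mem_space_iff, mem_iUnion]
  constructor
  · rintro ⟨s, hs, hx⟩
    obtain ⟨t, ht, hst, hc⟩ := T.pure s hs
    refine ⟨⟨t, ht, hc⟩, ?_⟩
    rw [simplexBody_basis]
    exact convexHull_mono (by exact_mod_cast hst) hx
  · rintro ⟨s, hx⟩
    rw [simplexBody_basis] at hx
    exact ⟨s, s.2.1, hx⟩

lemma simplexBody_subset_closure (s : T.elements) : simplexBody (T.basis s) ⊆ closure Ω := by
  rw [closure_eq_iUnion T]
  exact subset_iUnion (fun s : T.elements => simplexBody (T.basis s)) s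

lemma interior_simplexBody_subset (hΩ : IsPolyhedralDomain Ω) (s : T.elements) :
    interior (simplexBody (T.basis s)) ⊆ Ω := by
  have := interior_mono (simplexBody_subset_closure T s)
  rwa [hΩ.2.2.1] at this

variable {T} {s t u : T.elements} {p : s.1} {x : Euc d}

/-- An element containing a generic point of a facet contains the facet. -/
lemma IsFacePoint.subset (h : IsFacePoint (T.basis s) p x) (hx : x ∈ simplexBody (T.basis t)) :
    ∀ q : s.1, q ≠ p → (q : Euc d) ∈ t.1 := by
  intro q hq
  by_contra hqt
  have h1 : x ∈ simplexBody (T.basis s) := h.mem_simplexFace.1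
  rw [simplexBody_basis] at h1 hx
  have h2 := T.complex.inter_subset_convexHull s.2.1 t.2.1 ⟨h1, hx⟩
  have h3 := coord_eq_zero_of_mem_convexHull T s q inter_subset_left
    (fun h' => hqt (Finset.mem_coe.1 h'.2)) h2
  exact (h.2 q hq).ne' h3

/-- A count of vertices: both elements have `d + 1` of them and share the `d` vertices of the facet,
so each has exactly one more. -/
lemma exists_opposite_vertex (hsub : ∀ q : s.1, q ≠ p → (q : Euc d) ∈ t.1) (hst : t ≠ s) :
    ∃ q : t.1, (q : Euc d) ∉ s.1 ∧ (∀ r ∈ t.1, r ≠ q → r ∈ s.1 ∧ r ≠ p) ∧ (p : Euc d) ∉ t.1 := by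
  classical
  have h1 : s.1.erase p ⊆ t.1 := fun q hq =>
    hsub ⟨q, Finset.mem_of_mem_erase hq⟩ fun h' => (Finset.mem_erase.1 hq).1 (congrArg Subtype.val h')
  have hpt : (p : Euc d) ∉ t.1 := by
    intro hp
    have h2 : s.1 ⊆ t.1 := fun q hq => by
      by_cases hqp : q = p
      · rwa [hqp]
      · exact h1 (Finset.mem_erase.2 ⟨hqp, hq⟩)
    exact hst (Subtype.ext (Finset.eq_of_subset_of_card_le h2 (by rw [s.2.2, t.2.2])).symm)
  have hc : (t.1 \ s.1.erase p).card = 1 := by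
    rw [Finset.card_sdiff_of_subset h1, Finset.card_erase_of_mem p.2, s.2.2, t.2.2]
    omega
  obtain ⟨q, hq⟩ := Finset.card_eq_one.1 hc
  have hqm : q ∈ t.1 \ s.1.erase p := by rw [hq]; exact Finset.mem_singleton_self q
  rw [Finset.mem_sdiff] at hqm
  refine ⟨⟨q, hqm.1⟩, fun hqs => hqm.2 (Finset.mem_erase.2 ⟨?_, hqs⟩), fun r hr hrq => ?_, hpt⟩
  · rintro rfl; exact hpt hqm.1
  · by_contra hcon
    have : r ∈ t.1 \ s.1.erase p := by
      rw [Finset.mem_sdiff, Finset.mem_erase]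
      exact ⟨hr, fun h' => hcon ⟨h'.2, h'.1⟩⟩
    rw [hq, Finset.mem_singleton] at this
    exact hrq this

/-- Two distinct elements containing a generic point of a facet lie on opposite sides of it. -/
lemma IsFacePoint.exists_opposite [NeZero d] (h : IsFacePoint (T.basis s) p x)
    (hx : x ∈ simplexBody (T.basis t)) (hst : t ≠ s) :
    ∃ q : t.1, IsFacePoint (T.basis t) q x ∧
      ∃ c < 0, ∀ y, (T.basis t).coord q y = c * (T.basis s).coord p y := by
  have hsub := h.subset hx
  obtain ⟨q, hqs, hrest, hpt⟩ := exists_opposite_vertex hsub hst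
  have hx' := hx
  have hxs : x ∈ simplexBody (T.basis s) := h.mem_simplexFace.1
  rw [simplexBody_basis] at hxs hx'
  have hinter := T.complex.inter_subset_convexHull s.2.1 t.2.1 ⟨hxs, hx'⟩
  have hq0 : (T.basis t).coord q x = 0 :=
    coord_eq_zero_of_mem_convexHull T t q inter_subset_right
      (fun h' => hqs (Finset.mem_coe.1 h'.1)) hinter
  -- If a second coordinate of `x` in `t` vanished, `x` would lie in a face of `t` missing a vertex
  -- `r` of the facet. Conformity with that face would make the coordinate of `r` in `s` vanish at
  -- `x`.
  have hgen : IsFacePoint (T.basis t) q x := by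
    classical
    refine ⟨hq0, fun r hrq => lt_of_le_of_ne (hx r) fun h0 => ?_⟩
    have hr := hrest r r.2 fun h' => hrq (Subtype.ext h')
    have hmem : x ∈ simplexFace (T.basis t) r := ⟨hx, h0.symm⟩
    rw [simplexFace_basis, ← Finset.coe_erase] at hmem
    have hne : (t.1.erase r).Nonempty := by
      obtain ⟨r', hr'⟩ := exists_ne r
      exact ⟨r', Finset.mem_erase.2 ⟨fun h' => hr' (Subtype.ext h'), r'.2⟩⟩
    have hface := T.complex.down_closed t.2.1 (Finset.erase_subset (r : Euc d) t.1) hne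
    have h2 := T.complex.inter_subset_convexHull s.2.1 hface ⟨hxs, hmem⟩
    have h3 := coord_eq_zero_of_mem_convexHull T s ⟨r, hr.1⟩ inter_subset_left
      (fun h' => by simpa using h'.2) h2
    exact (h.2 ⟨r, hr.1⟩ fun h' => hr.2 (congrArg Subtype.val h')).ne' h3
  -- An affine function is determined by its values at the vertices of `s`, and this one vanishes at
  -- all of them except `p`.
  have hprop : ∀ y, (T.basis t).coord q y =
      (T.basis t).coord q p * (T.basis s).coord p y := by
    intro y
    have hsum := (T.basis s).sum_coord_apply_eq_one y
    have haff : y = Finset.univ.affineCombination ℝ (T.basis s)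
        fun r => (T.basis s).coord r y := ((T.basis s).affineCombination_coord_eq_self y).symm
    conv_lhs => rw [haff]
    rw [Finset.map_affineCombination _ _ _ hsum,
      Finset.affineCombination_eq_linear_combination _ _ _ hsum, Finset.sum_eq_single p]
    · simp [mul_comm]
    · intro r _ hrp
      have : (T.basis t).coord q (r : Euc d) = 0 := by
        have h4 := coord_vertex T t q ⟨r, hsub r hrp⟩
        rw [if_neg] at h4
        · exact h4
        · rintro rfl; exact hqs r.2
      simp [this]
    · intro h'; exact absurd (Finset.mem_univ p) h'
  refine ⟨q, hgen, _, ?_, hprop⟩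
  have hc0 : (T.basis t).coord q p ≠ 0 := by
    intro h0
    have h5 := hprop q
    rw [h0, zero_mul, coord_vertex, if_pos rfl] at h5
    exact one_ne_zero h5
  -- With a positive factor both elements would lie on the same side, and a nearby point strictly
  -- inside that side would belong to both. Conformity makes its coordinate at `p` vanish, since `p`
  -- is not a vertex of `t`.
  by_contra hneg
  have hpos : 0 < (T.basis t).coord q p := lt_of_le_of_ne (not_lt.1 hneg) hc0.symm
  obtain ⟨y, ⟨hy1, hy2⟩, hy⟩ := exists_coord_lt (T.basis s) p x
    (h.eventually_mem_body.and hgen.eventually_mem_body) 1 one_ne_zero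
  rw [one_mul, h.1, sub_zero] at hy
  have m1 := hy1.2 hy.le
  have m2 := hy2.2 (by rw [hprop]; positivity)
  rw [simplexBody_basis] at m1 m2
  have h6 := T.complex.inter_subset_convexHull s.2.1 t.2.1 ⟨m1, m2⟩
  have h7 := coord_eq_zero_of_mem_convexHull T s p inter_subset_left
    (fun h' => hpt (Finset.mem_coe.1 h'.2)) h6
  exact hy.ne' h7

lemma faceNormal_eq_neg [NeZero d] {q : t.1} {c : ℝ} (hc : c < 0)
    (h : ∀ y, (T.basis t).coord q y = c * (T.basis s).coord p y) :
    faceNormal (T.basis t) q = - faceNormal (T.basis s) p := by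
  have hg : coordGrad (T.basis t) q = c • coordGrad (T.basis s) p := by
    refine ext_inner_right ℝ fun y => ?_
    have h1 := h (0 + y)
    rw [coord_add, coord_add, h 0] at h1
    rw [real_inner_smul_left]
    linarith
  have hn : ‖coordGrad (T.basis s) p‖ ≠ 0 := by simpa using coordGrad_ne_zero (T.basis s) p
  rw [faceNormal, faceNormal, hg, norm_smul, Real.norm_eq_abs, abs_of_neg hc, smul_smul]
  congr 1
  rw [← neg_smul]
  congr 1
  have := hc.ne
  field_simp

/-- A generic point of a facet of two elements is interior to the domain. -/
lemma IsFacePoint.mem_of_two [NeZero d] (hΩ : IsPolyhedralDomain Ω)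
    (h : IsFacePoint (T.basis s) p x) (hx : x ∈ simplexBody (T.basis t)) (hst : t ≠ s) : x ∈ Ω := by
  obtain ⟨q, hq, c, hc, hcoord⟩ := h.exists_opposite hx hst
  rw [← hΩ.2.2.1, mem_interior_iff_mem_nhds]
  filter_upwards [h.eventually_mem_body, hq.eventually_mem_body] with y h1 h2
  rcases le_total 0 ((T.basis s).coord p y) with h0 | h0
  · exact simplexBody_subset_closure T s (h1.2 h0)
  · refine simplexBody_subset_closure T t (h2.2 ?_)
    rw [hcoord]
    exact mul_nonneg_of_nonpos_of_nonpos hc.le h0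

/-- At most two elements contain a generic point of a facet. -/
lemma IsFacePoint.eq_of_ne [NeZero d] (h : IsFacePoint (T.basis s) p x)
    (hx : x ∈ simplexBody (T.basis t)) (hst : t ≠ s)
    (hu : x ∈ simplexBody (T.basis u)) (hus : u ≠ s) : u = t := by
  by_contra hut
  obtain ⟨q, hq, c, hc, hcoord⟩ := h.exists_opposite hx hst
  obtain ⟨r, hr, c', hc', hcoord'⟩ := h.exists_opposite hu hus
  obtain ⟨r', hr', c'', hc'', hcoord''⟩ := hq.exists_opposite hu hut
  have hrr : r' = r := by
    by_contra hne
    exact (hr.2 r' hne).ne' hr'.1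
  subst hrr
  -- Three elements on the facet would have pairwise opposite unit normals, which is impossible.
  have e1 := faceNormal_eq_neg hc hcoord
  have e2 := faceNormal_eq_neg hc' hcoord'
  have e3 := faceNormal_eq_neg hc'' hcoord''
  rw [e1, neg_neg, e2] at e3
  have hz : ‖faceNormal (T.basis s) p‖ = ‖(0 : Euc d)‖ := by
    rw [neg_eq_iff_add_eq_zero, ← two_smul ℝ] at e3
    rw [(smul_eq_zero.1 e3).resolve_left two_ne_zero]
  rw [norm_faceNormal, norm_zero] at hz
  exact one_ne_zero hz

/-- Near a generic point of a facet of a single element, the domain is a half-space. -/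
lemma IsFacePoint.eventually_mem_iff [NeZero d] (hΩ : IsPolyhedralDomain Ω)
    (h : IsFacePoint (T.basis s) p x)
    (huniq : ∀ t : T.elements, x ∈ simplexBody (T.basis t) → t = s) :
    ∀ᶠ y in 𝓝 x, y ∈ Ω ↔ 0 < (T.basis s).coord p y := by
  have hcl : ∀ᶠ y in 𝓝 x, y ∈ closure Ω → 0 ≤ (T.basis s).coord p y := by
    have h1 : ∀ᶠ y in 𝓝 x, ∀ t : T.elements, t ≠ s → y ∉ simplexBody (T.basis t) := by
      refine eventually_all.2 fun t => ?_
      by_cases hts : t = s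
      · exact Eventually.of_forall fun y h' => absurd hts h'
      · have : x ∉ simplexBody (T.basis t) := fun h' => hts (huniq t h')
        filter_upwards [(isClosed_simplexBody (T.basis t)).isOpen_compl.mem_nhds this]
          with y hy _ using hy
    filter_upwards [h1] with y hy hyΩ
    rw [closure_eq_iUnion T, mem_iUnion] at hyΩ
    obtain ⟨t, ht⟩ := hyΩ
    by_cases hts : t = s
    · subst hts; exact ht p
    · exact absurd ht (hy t hts)
  filter_upwards [hcl.eventually_nhds, h.eventually_mem_interior] with y hy hint
  constructor
  · intro hyΩ
    -- A point of the open set `Ω` on the facet plane would have neighbours in `Ω` with negative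
    -- coordinate.
    refine lt_of_le_of_ne (hy.self_of_nhds (subset_closure hyΩ)) fun h0 => ?_
    obtain ⟨z, ⟨hz1, hz2⟩, hz⟩ := exists_coord_lt (T.basis s) p y
      (hy.and (hΩ.2.1.mem_nhds hyΩ)) (-1) (by norm_num)
    have := hz1 (subset_closure hz2)
    rw [← h0] at hz
    linarith
  · intro h0
    exact interior_simplexBody_subset T hΩ s (hint.2 h0)

lemma IsFacePoint.isOuterNormal [NeZero d] (hΩ : IsPolyhedralDomain Ω)
    (h : IsFacePoint (T.basis s) p x)
    (huniq : ∀ t : T.elements, x ∈ simplexBody (T.basis t) → t = s) :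
    IsOuterNormal Ω x (faceNormal (T.basis s) p) := by
  refine ⟨norm_faceNormal p, ?_⟩
  obtain ⟨ε, hε, hball⟩ := Metric.eventually_nhds_iff_ball.1 (h.eventually_mem_iff hΩ huniq)
  refine ⟨ε, hε, fun y hy => ?_⟩
  have hg : 0 < ‖coordGrad (T.basis s) p‖ := norm_pos_iff.2 (coordGrad_ne_zero _ p)
  rw [hball y hy, coord_eq_add _ p x y, h.1, zero_add, coordGrad_eq_smul_faceNormal,
    inner_neg_left, real_inner_smul_left, real_inner_comm, neg_pos]
  constructor
  · intro h'; by_contra hcon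
    exact absurd h' (not_lt.2 (mul_nonneg hg.le (not_lt.1 hcon)))
  · exact fun h' => mul_neg_of_pos_of_neg hg h'

lemma IsFacePoint.notMem_of_unique [NeZero d] (hΩ : IsPolyhedralDomain Ω)
    (h : IsFacePoint (T.basis s) p x)
    (huniq : ∀ t : T.elements, x ∈ simplexBody (T.basis t) → t = s) : x ∉ Ω := by
  rw [(h.eventually_mem_iff hΩ huniq).self_of_nhds, h.1]
  exact lt_irrefl 0

lemma IsFacePoint.unique_of_notMem [NeZero d] (hΩ : IsPolyhedralDomain Ω)
    (h : IsFacePoint (T.basis s) p x) (hx : x ∉ Ω) :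
    ∀ t : T.elements, x ∈ simplexBody (T.basis t) → t = s := by
  intro t ht
  by_contra hts
  exact hx (h.mem_of_two hΩ ht hts)

/-- A facet with a generic point on the boundary is contained in the boundary. -/
lemma IsFacePoint.simplexFace_subset_frontier [NeZero d] (hΩ : IsPolyhedralDomain Ω)
    (h : IsFacePoint (T.basis s) p x) (hx : x ∉ Ω) :
    simplexFace (T.basis s) p ⊆ frontier Ω := by
  have hfr : frontier Ω = closure Ω \ Ω := by rw [frontier, hΩ.2.1.interior_eq]
  -- Any element containing a generic point of the facet contains all its vertices, hence also `x`;
  -- uniqueness of the element thus transfers from `x` to `y`.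
  have hgen : ∀ y, IsFacePoint (T.basis s) p y → y ∈ frontier Ω := by
    intro y hy
    rw [hfr]
    refine ⟨simplexBody_subset_closure T s hy.mem_simplexFace.1,
      hy.notMem_of_unique hΩ fun t ht => ?_⟩
    refine h.unique_of_notMem hΩ hx t ?_
    have hsub := hy.subset ht
    have h1 := h.mem_simplexFace
    rw [simplexFace_basis] at h1
    rw [simplexBody_basis]
    refine convexHull_mono (fun q hq => ?_) h1
    exact hsub ⟨q, hq.1⟩ fun h' => hq.2 (congrArg Subtype.val h')
  intro y hy
  -- Every other point of the facet is a limit of generic ones along the segment towards `x`, and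
  -- the frontier is closed.
  have hlim : Tendsto (fun τ : ℝ => AffineMap.lineMap y x τ) (𝓝[>] 0) (𝓝 y) := by
    have hcont : Continuous fun τ : ℝ => AffineMap.lineMap y x τ :=
      AffineMap.lineMap_continuous
    have := hcont.tendsto 0
    rw [AffineMap.lineMap_apply_zero] at this
    exact this.mono_left nhdsWithin_le_nhds
  refine isClosed_frontier.mem_of_tendsto hlim ?_
  have hlt : ∀ᶠ τ : ℝ in 𝓝[>] 0, τ < 1 := nhdsWithin_le_nhds (gt_mem_nhds one_pos)
  filter_upwards [hlt, self_mem_nhdsWithin] with τ h1 h0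
  have h0' : (0 : ℝ) < τ := h0
  refine hgen _ ⟨?_, fun q hq => ?_⟩
  · rw [AffineMap.apply_lineMap, h.1, hy.2, AffineMap.lineMap_same, AffineMap.const_apply]
  · rw [AffineMap.apply_lineMap, AffineMap.lineMap_apply_ring]
    have := hy.1 q
    have := h.2 q hq
    have : 0 ≤ (1 - τ) * (T.basis s).coord q y := mul_nonneg (by linarith) (hy.1 q)
    have : 0 < τ * (T.basis s).coord q x := mul_pos h0' (h.2 q hq)
    linarith

/-- The point `x + τ • (ν - ν')` separates two different candidates: for small `τ > 0` it is inside
according to `ν'` and not inside according to `ν`. -/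
lemma IsOuterNormal.unique {ν ν' : Euc d} (h : IsOuterNormal Ω x ν) (h' : IsOuterNormal Ω x ν') :
    ν = ν' := by
  obtain ⟨hn, ε, hε, hb⟩ := h
  obtain ⟨hn', ε', hε', hb'⟩ := h'
  by_contra hne
  have hlt : inner ℝ ν ν' < 1 := by
    refine lt_of_le_of_ne ?_ fun h1 => hne ((inner_eq_one_iff_of_norm_eq_one hn hn').1 h1)
    have := real_inner_le_norm ν ν'
    rwa [hn, hn', mul_one] at this
  set w := ν - ν' with hw
  set τ := min ε ε' / 4 with hτ
  have hτ0 : 0 < τ := by positivity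
  have hwn : ‖w‖ ≤ 2 := by
    have := norm_sub_le ν ν'
    rw [hn, hn'] at this; linarith
  have hmem : ∀ δ, min ε ε' ≤ δ → x + τ • w ∈ Metric.ball x δ := by
    intro δ hδ
    rw [Metric.mem_ball, dist_eq_norm, add_sub_cancel_left, norm_smul, Real.norm_eq_abs,
      abs_of_pos hτ0]
    have hm : 0 < min ε ε' := by positivity
    calc τ * ‖w‖ ≤ τ * 2 := by gcongr
      _ < δ := by rw [hτ]; linarith
  have k1 := hb _ (hmem ε (min_le_left _ _))
  have k2 := hb' _ (hmem ε' (min_le_right _ _))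
  rw [add_sub_cancel_left, real_inner_smul_left, hw, inner_sub_left] at k1 k2
  rw [real_inner_self_eq_norm_sq, hn, real_inner_comm] at k1
  rw [real_inner_self_eq_norm_sq, hn'] at k2
  have a1 : ¬ τ * (1 ^ 2 - inner ℝ ν ν') < 0 := by
    rw [not_lt]; exact mul_nonneg hτ0.le (by linarith)
  have a2 : τ * (inner ℝ ν ν' - 1 ^ 2) < 0 := mul_neg_of_pos_of_neg hτ0 (by linarith)
  exact a1 (k1.1 (k2.2 a2))

lemma IsOuterNormal.outerNormal_eq {ν : Euc d} (h : IsOuterNormal Ω x ν) : outerNormal Ω x = ν := by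
  have hex : ∃ ν, IsOuterNormal Ω x ν := ⟨ν, h⟩
  rw [outerNormal, dif_pos hex]
  exact hex.choose_spec.unique h

end Triangulation

/-! ### Green's formula on a polyhedral domain -/

section Global

variable {Ω : Set (Euc d)} (T : Triangulation Ω)

instance fintype_elements : Fintype T.elements := Fintype.ofFinite _

/-- The pairs of an element and one of its vertices, standing for the facet opposite to it. -/
abbrev Triangulation.Facet : Type := Σ s : T.elements, s.1

variable {T} in
/-- The facet as a set. -/
def facetSet (φ : T.Facet) : Set (Euc d) := simplexFace (T.basis φ.1) φ.2

variable {T} in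
/-- The open element adjacent to a facet. -/
def facetCell (φ : T.Facet) : Set (Euc d) := interior (simplexBody (T.basis φ.1))

variable {T} in
/-- The normal to a facet pointing out of the element. -/
def facetNormal (φ : T.Facet) : Euc d := faceNormal (T.basis φ.1) φ.2

open Classical in
variable {T} in
/-- The trace of a function on a facet, taken from the adjacent element. -/
def facetTrace (φ : T.Facet) (v : Euc d → ℝ) : Euc d → ℝ :=
  if h : ∃ g, HasTrace (facetCell φ) (facetSet φ) v g then h.choose else 0

/-- The union of all facets. -/
def skeleton : Set (Euc d) := ⋃ φ : T.Facet, facetSet φ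

variable {T} {v w g : Euc d → ℝ} {x : Euc d}

lemma isClosed_facetSet (φ : T.Facet) : IsClosed (facetSet φ) := isClosed_simplexFace _ _

lemma isClosed_skeleton : IsClosed (skeleton T) :=
  isClosed_iUnion_of_finite isClosed_facetSet

lemma facetSet_subset_skeleton (φ : T.Facet) : facetSet φ ⊆ skeleton T :=
  subset_iUnion (fun φ : T.Facet => facetSet φ) φ

instance isFiniteMeasure_surf_skeleton [NeZero d] :
    IsFiniteMeasure ((surf d).restrict (skeleton T)) := by
  constructor
  rw [Measure.restrict_apply_univ, skeleton]
  refine (measure_iUnion_le _).trans_lt ?_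
  rw [tsum_fintype]
  exact ENNReal.sum_lt_top.2 fun φ _ => surf_simplexFace_lt_top _ _

lemma restrict_skeleton_restrict {A : Set (Euc d)} (hA : A ⊆ skeleton T) (hm : MeasurableSet A) :
    ((surf d).restrict (skeleton T)).restrict A = (surf d).restrict A := by
  rw [Measure.restrict_restrict hm, inter_eq_self_of_subset_left hA]

/-- The exceptional points lie on two faces of one element, and there are finitely many such null
intersections. -/
lemma ae_isFacePoint [NeZero d] :
    ∀ᵐ x ∂(surf d), ∀ φ : T.Facet, x ∈ facetSet φ → IsFacePoint (T.basis φ.1) φ.2 x := by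
  refine ae_all_iff.2 fun φ => ?_
  have : ∀ᵐ x ∂(surf d), ∀ j, j ≠ φ.2 →
      x ∉ simplexFace (T.basis φ.1) φ.2 ∩ simplexFace (T.basis φ.1) j := by
    refine ae_all_iff.2 fun j => ?_
    by_cases hj : j = φ.2
    · exact Eventually.of_forall fun x h' => absurd hj h'
    · filter_upwards [measure_eq_zero_iff_ae_notMem.1
        (surf_simplexFace_inter_eq_zero (T.basis φ.1) (Ne.symm hj))] with x hx _ using hx
  filter_upwards [this] with x hx hφ
  refine ⟨hφ.2, fun j hj => lt_of_le_of_ne (hφ.1 j) fun h0 => hx j hj ⟨hφ, hφ.1, h0.symm⟩⟩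

lemma facet_ext {φ ψ : T.Facet} (h : IsFacePoint (T.basis φ.1) φ.2 x)
    (h' : IsFacePoint (T.basis ψ.1) ψ.2 x) (he : φ.1 = ψ.1) : φ = ψ := by
  obtain ⟨s, p⟩ := φ
  obtain ⟨t, q⟩ := ψ
  obtain rfl : s = t := he
  congr 1
  by_contra hne
  exact (h'.2 p hne).ne' h.1

lemma facetCell_subset (hΩ : IsPolyhedralDomain Ω) (φ : T.Facet) : facetCell φ ⊆ Ω :=
  interior_simplexBody_subset T hΩ φ.1

lemma hasTrace_facetTrace [NeZero d] (hΩ : IsPolyhedralDomain Ω) (hv : MemH1 Ω v) (φ : T.Facet) :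
    HasTrace (facetCell φ) (facetSet φ) v (facetTrace φ v) := by
  have hex : ∃ g, HasTrace (facetCell φ) (facetSet φ) v g :=
    exists_hasTrace_simplexFace (T.basis φ.1) (NeZero.ne d) φ.2 (hv.mono (facetCell_subset hΩ φ))
  rw [facetTrace, dif_pos hex]
  exact hex.choose_spec

lemma HasTrace.ae_eq_facetTrace [NeZero d] {φ : T.Facet}
    (h : HasTrace (facetCell φ) (facetSet φ) v g) :
    facetTrace φ v =ᵐ[(surf d).restrict (facetSet φ)] g := by
  have hex : ∃ g, HasTrace (facetCell φ) (facetSet φ) v g := ⟨g, h⟩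
  rw [facetTrace, dif_pos hex]
  exact HasTrace.ae_unique (T.basis φ.1) (NeZero.ne d) hex.choose_spec h

lemma isBounded_domain (T : Triangulation Ω) : Bornology.IsBounded Ω := by
  refine Bornology.IsBounded.subset ?_ subset_closure
  rw [closure_eq_iUnion T]
  exact Bornology.isBounded_iUnion.2 fun s => (isCompact_simplexBody _).isBounded

lemma disjoint_interior_simplexBody {s t : T.elements} (hst : s ≠ t) :
    Disjoint (interior (simplexBody (T.basis s))) (interior (simplexBody (T.basis t))) := by
  rw [Set.disjoint_left]
  intro x hs ht
  have h1 := interior_subset hs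
  have h2 := interior_subset ht
  rw [simplexBody_basis] at h1 h2
  have h3 := T.complex.inter_subset_convexHull s.2.1 t.2.1 ⟨h1, h2⟩
  obtain ⟨q, hqs, hqt⟩ : ∃ q ∈ s.1, q ∉ t.1 := by
    by_contra! hcon
    exact hst (Subtype.ext (Finset.eq_of_subset_of_card_le hcon (by rw [s.2.2, t.2.2])))
  have h4 := coord_eq_zero_of_mem_convexHull T s ⟨q, hqs⟩ inter_subset_left
    (fun h' => hqt (Finset.mem_coe.1 h'.2)) h3
  rw [interior_simplexBody] at hs
  exact (hs ⟨q, hqs⟩).ne' h4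

/-- The open elements are disjoint and miss only boundaries of convex sets, which have volume zero.
-/
lemma integral_domain_eq_sum (hΩ : IsPolyhedralDomain Ω) (T : Triangulation Ω) {f : Euc d → ℝ}
    (hf : IntegrableOn f Ω) :
    ∫ x in Ω, f x = ∑ s : T.elements, ∫ x in interior (simplexBody (T.basis s)), f x := by
  have hae : (⋃ s : T.elements, interior (simplexBody (T.basis s)) : Set (Euc d)) =ᵐ[volume] Ω := by
    refine (LE.le.eventuallyLE
      (iUnion_subset fun s => interior_simplexBody_subset T hΩ s)).antisymm ?_
    have h1 : ∀ᵐ x : Euc d, ∀ s : T.elements, x ∉ frontier (simplexBody (T.basis s)) :=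
      ae_all_iff.2 fun s => measure_eq_zero_iff_ae_notMem.1
        ((convex_simplexBody (T.basis s)).addHaar_frontier volume)
    filter_upwards [h1] with x hx hxΩ
    have h2 : x ∈ closure Ω := subset_closure hxΩ
    rw [closure_eq_iUnion T] at h2
    obtain ⟨s, hs⟩ := mem_iUnion.1 h2
    refine mem_iUnion.2 ⟨s, ?_⟩
    by_contra hni
    exact hx s ⟨subset_closure hs, hni⟩
  rw [← setIntegral_congr_set hae, integral_iUnion_fintype
    (fun s => isOpen_interior.measurableSet) (fun s t hst => disjoint_interior_simplexBody hst)
    (fun s => hf.mono_set (interior_simplexBody_subset T hΩ s))]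

lemma facet_memLp [NeZero d] (hΩ : IsPolyhedralDomain Ω) (hv : MemH1 Ω v) (φ : T.Facet) :
    MemLp (facetTrace φ v) 2 ((surf d).restrict (facetSet φ)) :=
  (hasTrace_facetTrace hΩ hv φ).2.1

/-- The sum over all facets of the normal fluxes of a product of traces. -/
def flux (T : Triangulation Ω) (k : Fin d) (v w : Euc d → ℝ) (x : Euc d) : ℝ :=
  ∑ φ : T.Facet, (facetSet φ).indicator
    (fun y => facetNormal φ k * (facetTrace φ v y * facetTrace φ w y)) x

lemma integrable_flux_summand [NeZero d] (hΩ : IsPolyhedralDomain Ω) (hv : MemH1 Ω v)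
    (hw : MemH1 Ω w) (k : Fin d) (φ : T.Facet) :
    Integrable ((facetSet φ).indicator
      fun y => facetNormal φ k * (facetTrace φ v y * facetTrace φ w y))
      ((surf d).restrict (skeleton T)) := by
  rw [integrable_indicator_iff (isClosed_facetSet φ).measurableSet, IntegrableOn,
    restrict_skeleton_restrict (facetSet_subset_skeleton φ) (isClosed_facetSet φ).measurableSet]
  exact ((facet_memLp hΩ hv φ).integrable_mul (facet_memLp hΩ hw φ)).const_mul _

lemma integrable_flux [NeZero d] (hΩ : IsPolyhedralDomain Ω) (hv : MemH1 Ω v) (hw : MemH1 Ω w)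
    (k : Fin d) : Integrable (flux T k v w) ((surf d).restrict (skeleton T)) :=
  integrable_finsetSum _ fun φ _ => integrable_flux_summand hΩ hv hw k φ

/-- Elementwise integration by parts. -/
lemma integral_by_parts_flux [NeZero d] (hΩ : IsPolyhedralDomain Ω) (T : Triangulation Ω)
    (hv : MemH1 Ω v) (hw : MemH1 Ω w) (k : Fin d) :
    (∫ x in Ω, v x * weakPartial Ω k w x) + (∫ x in Ω, w x * weakPartial Ω k v x) =
      ∫ x in skeleton T, flux T k v w x ∂(surf d) := by
  have i1 : IntegrableOn (fun x => v x * weakPartial Ω k w x) Ω :=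
    hv.1.integrable_mul (hw.memL2_weakPartial k)
  have i2 : IntegrableOn (fun x => w x * weakPartial Ω k v x) Ω :=
    hw.1.integrable_mul (hv.memL2_weakPartial k)
  simp only [flux]
  rw [integral_finsetSum _ fun φ _ => integrable_flux_summand hΩ hv hw k φ, Fintype.sum_sigma,
    integral_domain_eq_sum hΩ T i1, integral_domain_eq_sum hΩ T i2, ← Finset.sum_add_distrib]
  refine Finset.sum_congr rfl fun s _ => ?_
  have hsub := interior_simplexBody_subset T hΩ s
  -- Weak derivatives chosen on `Ω` and on the element agree almost everywhere on the element.
  have e : ∀ {a c : Euc d → ℝ}, MemH1 Ω c →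
      ∫ x in interior (simplexBody (T.basis s)), a x * weakPartial Ω k c x =
      ∫ x in interior (simplexBody (T.basis s)),
        a x * weakPartial (interior (simplexBody (T.basis s))) k c x := by
    intro a c hc
    refine integral_congr_ae ?_
    filter_upwards [weakPartial_mono_ae_eq isOpen_interior hsub hc k] with x hx
    rw [hx]
  rw [e hw, e hv, integral_simplexBody_by_parts (T.basis s) (NeZero.ne d) (hv.mono hsub)
    (hw.mono hsub) (fun p => hasTrace_facetTrace hΩ hv (⟨s, p⟩ : T.Facet))
    (fun p => hasTrace_facetTrace hΩ hw (⟨s, p⟩ : T.Facet))]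
  refine Finset.sum_congr rfl fun p _ => ?_
  have hm := (isClosed_facetSet (⟨s, p⟩ : T.Facet)).measurableSet
  rw [integral_indicator hm, restrict_skeleton_restrict (facetSet_subset_skeleton _) hm,
    integral_const_mul]
  rfl

lemma memLp_surf_of_continuous {A : Set (Euc d)} (hA : Bornology.IsBounded A)
    (h : surf d A < ⊤) {f : Euc d → ℝ} (hf : Continuous f) :
    MemLp f 2 ((surf d).restrict A) := by
  have : IsFiniteMeasure ((surf d).restrict A) := ⟨by simpa using h⟩
  exact memLp_of_continuous_of_isBounded hA hf

lemma facetTrace_of_contDiff [NeZero d] (φ : T.Facet) {η : Euc d → ℝ} (hη : ContDiff ℝ ∞ η) :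
    facetTrace φ η =ᵐ[(surf d).restrict (facetSet φ)] η :=
  (hasTrace_of_contDiff isOpen_interior (isBounded_interior_simplexBody _) hη
    (memLp_surf_of_continuous (isCompact_simplexFace _ _).isBounded
      (surf_simplexFace_lt_top _ _) hη.continuous)).ae_eq_facetTrace

/-- The sum over all facets of the normal multiples of the traces. -/
def jump (T : Triangulation Ω) (k : Fin d) (v : Euc d → ℝ) (x : Euc d) : ℝ :=
  ∑ φ : T.Facet, (facetSet φ).indicator (fun y => facetNormal φ k * facetTrace φ v y) x

/-- Functions in `H¹(Ω)` have no jumps across the facets in `Ω`. -/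
lemma jump_ae_eq_zero [NeZero d] (hΩ : IsPolyhedralDomain Ω) (T : Triangulation Ω)
    (hv : MemH1 Ω v) (k : Fin d) :
    ∀ᵐ x ∂((surf d).restrict (skeleton T)), x ∈ Ω → jump T k v x = 0 := by
  refine hΩ.2.1.ae_eq_zero_of_integral_contDiff_smul_eq_zero ?_ fun η h1 h2 h3 => ?_
  · refine Integrable.locallyIntegrable ?_ |>.locallyIntegrableOn _
    refine integrable_finsetSum _ fun φ _ => ?_
    rw [integrable_indicator_iff (isClosed_facetSet φ).measurableSet, IntegrableOn,
      restrict_skeleton_restrict (facetSet_subset_skeleton φ) (isClosed_facetSet φ).measurableSet]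
    have : IsFiniteMeasure ((surf d).restrict (facetSet φ)) :=
      isFiniteMeasure_surf_simplexFace (T.basis φ.1) φ.2
    exact ((facet_memLp hΩ hv φ).integrable (by norm_num)).const_mul _
  · have hb := isBounded_domain T
    have hη := memH1_of_contDiff hb h1
    -- For a test function supported in `Ω`, the volume terms cancel by the definition of the weak
    -- derivative. What remains says that the jump is orthogonal to `η` in the surface measure of
    -- the skeleton.
    have key := integral_by_parts_flux hΩ T hv hη k
    have e1 : ∫ x in Ω, v x * weakPartial Ω k η x = ∫ x in Ω, v x * partialDeriv k η x := by
      refine integral_congr_ae ?_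
      filter_upwards [(isWeakPartial_partialDeriv hb h1 k).weakPartial_ae_eq hΩ.2.1] with x hx
      rw [hx]
    rw [e1, (isWeakPartial_weakPartial hv k).2 η h1 h2 h3] at key
    simp_rw [mul_comm (η _)] at key
    rw [neg_add_cancel] at key
    rw [key]
    refine integral_congr_ae ?_
    have hall : ∀ᵐ x ∂((surf d).restrict (skeleton T)), ∀ φ : T.Facet, x ∈ facetSet φ →
        facetTrace φ η x = η x := by
      refine ae_all_iff.2 fun φ => ?_
      have hm := (isClosed_facetSet φ).measurableSet
      have := facetTrace_of_contDiff φ h1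
      rw [← restrict_skeleton_restrict (facetSet_subset_skeleton φ) hm] at this
      exact (ae_restrict_iff' hm).1 this
    filter_upwards [hall] with x hx
    rw [flux, jump, smul_eq_mul, Finset.mul_sum]
    refine Finset.sum_congr rfl fun φ _ => ?_
    by_cases hφ : x ∈ facetSet φ
    · rw [indicator_of_mem hφ, indicator_of_mem hφ, hx φ hφ]; ring
    · rw [indicator_of_notMem hφ, indicator_of_notMem hφ, mul_zero]

/-- At a generic interior point of the skeleton, exactly two facets with opposite normals meet. -/
lemma exists_opposite_facet [NeZero d] (hΩ : IsPolyhedralDomain Ω)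
    (hgen : ∀ φ : T.Facet, x ∈ facetSet φ → IsFacePoint (T.basis φ.1) φ.2 x) (hx : x ∈ Ω)
    {φ : T.Facet} (hφ : x ∈ facetSet φ) :
    ∃ ψ : T.Facet, ψ ≠ φ ∧ facetNormal ψ = - facetNormal φ ∧
      ∀ F : T.Facet → Euc d → ℝ, ∑ χ : T.Facet, (facetSet χ).indicator (F χ) x = F φ x + F ψ x := by
  have hp := hgen φ hφ
  obtain ⟨t, ht, hts⟩ : ∃ t : T.elements, x ∈ simplexBody (T.basis t) ∧ t ≠ φ.1 := by
    by_contra! hcon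
    exact hp.notMem_of_unique hΩ hcon hx
  obtain ⟨q, hq, c, hc, hcoord⟩ := hp.exists_opposite ht hts
  have hne : (⟨t, q⟩ : T.Facet) ≠ φ := fun h' => hts (congrArg Sigma.fst h')
  have hmem : x ∈ facetSet (⟨t, q⟩ : T.Facet) := hq.mem_simplexFace
  refine ⟨⟨t, q⟩, hne, faceNormal_eq_neg hc hcoord, fun F => ?_⟩
  rw [Fintype.sum_eq_add φ ⟨t, q⟩ hne.symm, indicator_of_mem hφ, indicator_of_mem hmem]
  rintro χ ⟨h1, h2⟩
  refine indicator_of_notMem (fun hχ => ?_) _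
  have hχp := hgen χ hχ
  by_cases hs : χ.1 = φ.1
  · exact h1 (facet_ext hχp hp hs)
  · exact h2 (facet_ext hχp hq (hp.eq_of_ne ht hts hχ.1 hs))

/-- At a generic boundary point, exactly one facet is present. -/
lemma sum_facet_of_notMem [NeZero d] (hΩ : IsPolyhedralDomain Ω)
    (hgen : ∀ φ : T.Facet, x ∈ facetSet φ → IsFacePoint (T.basis φ.1) φ.2 x) (hx : x ∉ Ω)
    {φ : T.Facet} (hφ : x ∈ facetSet φ) (F : T.Facet → Euc d → ℝ) :
    ∑ χ : T.Facet, (facetSet χ).indicator (F χ) x = F φ x := by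
  rw [Fintype.sum_eq_single φ, indicator_of_mem hφ]
  intro χ hne
  refine indicator_of_notMem (fun hχ => hne ?_) _
  exact facet_ext (hgen χ hχ) (hgen φ hφ) ((hgen φ hφ).unique_of_notMem hΩ hx _ hχ.1)

/-- At a generic point exactly two facets with opposite normals contribute. Vanishing jumps make
their traces equal, so the two fluxes cancel. -/
lemma flux_ae_eq_zero [NeZero d] (hΩ : IsPolyhedralDomain Ω) (T : Triangulation Ω)
    (hv : MemH1 Ω v) (hw : MemH1 Ω w) (k : Fin d) :
    ∀ᵐ x ∂((surf d).restrict (skeleton T)), x ∈ Ω → flux T k v w x = 0 := by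
  filter_upwards [ae_all_iff.2 fun k => jump_ae_eq_zero hΩ T hv k,
    ae_all_iff.2 fun k => jump_ae_eq_zero hΩ T hw k,
    ae_restrict_of_ae (ae_isFacePoint (T := T)), ae_restrict_mem isClosed_skeleton.measurableSet]
    with x hv0 hw0 hgen hxs hx
  obtain ⟨φ, hφ⟩ := mem_iUnion.1 hxs
  obtain ⟨ψ, -, hn, hsum⟩ := exists_opposite_facet hΩ hgen hx hφ
  -- A jump carries a component of the normal as a factor, so equality of traces is read off in a
  -- direction where this component is nonzero; it need not be `k`.
  obtain ⟨j, hj⟩ : ∃ j, facetNormal φ j ≠ 0 := by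
    by_contra! hcon
    have h0 : facetNormal φ = 0 := by ext j; simpa using hcon j
    have := norm_faceNormal (b := T.basis φ.1) φ.2
    rw [show faceNormal (T.basis φ.1) φ.2 = 0 from h0, norm_zero] at this
    exact zero_ne_one this
  have hjump : ∀ {a : Euc d → ℝ}, jump T j a x = 0 → facetTrace φ a x = facetTrace ψ a x := by
    intro a ha
    rw [jump, hsum, hn, PiLp.neg_apply, neg_mul, ← sub_eq_add_neg, ← mul_sub] at ha
    exact sub_eq_zero.1 ((mul_eq_zero.1 ha).resolve_left hj)
  rw [flux, hsum, hn, PiLp.neg_apply, hjump (hv0 j hx), hjump (hw0 j hx)]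
  ring

/-! ### Elementwise traces on the boundary and global integration by parts -/

lemma frontier_eq (hΩ : IsPolyhedralDomain Ω) : frontier Ω = closure Ω \ Ω := by
  rw [frontier, hΩ.2.1.interior_eq]

lemma frontier_subset_skeleton (hΩ : IsPolyhedralDomain Ω) (T : Triangulation Ω) :
    frontier Ω ⊆ skeleton T := by
  rw [frontier_eq hΩ]
  rintro x ⟨hx, hxΩ⟩
  rw [closure_eq_iUnion T] at hx
  obtain ⟨s, hs⟩ := mem_iUnion.1 hx
  have h1 : x ∉ interior (simplexBody (T.basis s)) := fun h' =>
    hxΩ (interior_simplexBody_subset T hΩ s h')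
  rw [interior_simplexBody, mem_ofPred_eq] at h1
  push Not at h1
  obtain ⟨p, hp⟩ := h1
  exact mem_iUnion.2 ⟨(⟨s, p⟩ : T.Facet), hs, le_antisymm hp (hs p)⟩

lemma skeleton_subset_closure (T : Triangulation Ω) : skeleton T ⊆ closure Ω :=
  iUnion_subset fun φ _ hx => simplexBody_subset_closure T φ.1 hx.1

lemma isBdryTrace_iff : IsBdryTrace T v g ↔
    ∀ φ : T.Facet, facetSet φ ⊆ frontier Ω → HasTrace (facetCell φ) (facetSet φ) v g := by
  simp only [facetSet, facetCell, simplexFace_basis, simplexBody_basis]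
  exact ⟨fun h φ => h φ.1 φ.1.2 φ.2 φ.2.2, fun h s hs p hp => h ⟨⟨s, hs⟩, ⟨p, hp⟩⟩⟩

lemma exists_isBdryTrace [NeZero d] (hΩ : IsPolyhedralDomain Ω) (T : Triangulation Ω)
    (hv : MemH1 Ω v) : ∃ g, IsBdryTrace T v g := by
  -- At almost every boundary point only one summand is present, so the sum glues the facet traces
  -- together.
  refine ⟨fun x => ∑ φ : T.Facet, (facetSet φ).indicator (facetTrace φ v) x,
    isBdryTrace_iff.2 fun φ hφ => (hasTrace_facetTrace hΩ hv φ).congr ?_⟩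
  filter_upwards [ae_restrict_of_ae (ae_isFacePoint (T := T)),
    ae_restrict_mem (isClosed_facetSet φ).measurableSet] with x hgen hx
  have hxΩ := hφ hx
  rw [frontier_eq hΩ] at hxΩ
  exact (sum_facet_of_notMem hΩ hgen hxΩ.2 hx
    fun φ => facetTrace φ v).symm

lemma isBdryTrace_bdryTrace [NeZero d] (hΩ : IsPolyhedralDomain Ω) (T : Triangulation Ω)
    (hv : MemH1 Ω v) : IsBdryTrace T v (bdryTrace T v) := by
  have hex := exists_isBdryTrace hΩ T hv
  rw [bdryTrace, dif_pos hex]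
  exact hex.choose_spec

/-- At almost every boundary point a boundary facet is present, on which the boundary traces are the
traces on the facet. -/
lemma IsBdryTrace.ae_exists_facet [NeZero d] (hΩ : IsPolyhedralDomain Ω)
    (h : IsBdryTrace T v g) : ∀ᵐ x ∂((surf d).restrict (frontier Ω)), ∀ φ : T.Facet,
      x ∈ facetSet φ → g x = facetTrace φ v x := by
  refine ae_all_iff.2 fun φ => ?_
  by_cases hφ : facetSet φ ⊆ frontier Ω
  · have h1 := (isBdryTrace_iff.1 h φ hφ).ae_eq_facetTrace
    have h2 := (ae_restrict_iff' (isClosed_facetSet φ).measurableSet).1 h1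
    filter_upwards [ae_restrict_of_ae h2] with x hx hxφ using (hx hxφ).symm
  -- A facet with a generic boundary point lies wholly in the boundary; the remaining facets meet
  -- the boundary in null sets.
  · filter_upwards [ae_restrict_of_ae (ae_isFacePoint (T := T)),
      ae_restrict_mem isClosed_frontier.measurableSet] with x hgen hx hxφ
    rw [frontier_eq hΩ] at hx
    exact absurd ((hgen φ hxφ).simplexFace_subset_frontier hΩ hx.2) hφ

lemma IsBdryTrace.ae_unique [NeZero d] (hΩ : IsPolyhedralDomain Ω) {g' : Euc d → ℝ}
    (h : IsBdryTrace T v g) (h' : IsBdryTrace T v g') :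
    g =ᵐ[(surf d).restrict (frontier Ω)] g' := by
  filter_upwards [h.ae_exists_facet hΩ, h'.ae_exists_facet hΩ,
    ae_restrict_mem isClosed_frontier.measurableSet] with x h1 h2 hx
  obtain ⟨φ, hφ⟩ := mem_iUnion.1 (frontier_subset_skeleton hΩ T hx)
  rw [h1 φ hφ, h2 φ hφ]

lemma HasTrace.isBdryTrace (hΩ : IsPolyhedralDomain Ω) (T : Triangulation Ω)
    (h : HasTrace Ω (frontier Ω) v g) : IsBdryTrace T v g :=
  isBdryTrace_iff.2 fun φ hφ => h.mono isOpen_interior (facetCell_subset hΩ φ) hφ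

/-- Identifies the global trace used to define `V` and `W` with the elementwise trace used in `a_h`.
-/
lemma HasTrace.bdryTrace_ae_eq [NeZero d] (hΩ : IsPolyhedralDomain Ω) (T : Triangulation Ω)
    (h : HasTrace Ω (frontier Ω) v g) :
    bdryTrace T v =ᵐ[(surf d).restrict (frontier Ω)] g :=
  (isBdryTrace_bdryTrace hΩ T h.1).ae_unique hΩ (h.isBdryTrace hΩ T)

/-- Almost every boundary point lies on a single facet, near which `Ω` is a half-space with the
normal of that facet. -/
lemma flux_ae_eq [NeZero d] (hΩ : IsPolyhedralDomain Ω) (T : Triangulation Ω)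
    (hv : MemH1 Ω v) (hw : MemH1 Ω w) (k : Fin d) :
    flux T k v w =ᵐ[(surf d).restrict (frontier Ω)]
      fun x => outerNormal Ω x k * (bdryTrace T v x * bdryTrace T w x) := by
  filter_upwards [(isBdryTrace_bdryTrace hΩ T hv).ae_exists_facet hΩ,
    (isBdryTrace_bdryTrace hΩ T hw).ae_exists_facet hΩ,
    ae_restrict_of_ae (ae_isFacePoint (T := T)),
    ae_restrict_mem isClosed_frontier.measurableSet] with x h1 h2 hgen hx
  obtain ⟨φ, hφ⟩ := mem_iUnion.1 (frontier_subset_skeleton hΩ T hx)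
  rw [frontier_eq hΩ] at hx
  have hp := hgen φ hφ
  rw [flux, sum_facet_of_notMem hΩ hgen hx.2 hφ, h1 φ hφ, h2 φ hφ,
    (hp.isOuterNormal hΩ (hp.unique_of_notMem hΩ hx.2)).outerNormal_eq]
  rfl

lemma integrableOn_bdry [NeZero d] (hΩ : IsPolyhedralDomain Ω) (T : Triangulation Ω)
    (hv : MemH1 Ω v) (hw : MemH1 Ω w) (k : Fin d) :
    IntegrableOn (fun x => outerNormal Ω x k * (bdryTrace T v x * bdryTrace T w x))
      (frontier Ω) (surf d) := by
  refine Integrable.congr ?_ (flux_ae_eq hΩ T hv hw k)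
  exact (integrable_flux hΩ hv hw k).mono_measure
    (Measure.restrict_mono (frontier_subset_skeleton hΩ T) le_rfl)

/-- Integration by parts on a polyhedral domain. -/
lemma integral_by_parts [NeZero d] (hΩ : IsPolyhedralDomain Ω) (T : Triangulation Ω)
    (hv : MemH1 Ω v) (hw : MemH1 Ω w) (k : Fin d) :
    (∫ x in Ω, v x * weakPartial Ω k w x) + (∫ x in Ω, w x * weakPartial Ω k v x) =
      ∫ x in frontier Ω, outerNormal Ω x k * (bdryTrace T v x * bdryTrace T w x) ∂(surf d) := by
  have hm : MeasurableSet (frontier Ω) := isClosed_frontier.measurableSet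
  have hsub := frontier_subset_skeleton hΩ T
  rw [integral_by_parts_flux hΩ T hv hw k, ← integral_congr_ae (flux_ae_eq hΩ T hv hw k),
    ← restrict_skeleton_restrict hsub hm, ← integral_indicator hm]
  refine integral_congr_ae ?_
  filter_upwards [flux_ae_eq_zero hΩ T hv hw k,
    ae_restrict_mem isClosed_skeleton.measurableSet] with x h0 hx
  by_cases hf : x ∈ frontier Ω
  · rw [indicator_of_mem hf]
  · rw [indicator_of_notMem hf]
    refine h0 ?_
    by_contra hxΩ
    rw [frontier_eq hΩ] at hf
    exact hf ⟨skeleton_subset_closure T hx, hxΩ⟩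

/-! ### Green's formula -/

variable {u : Euc d → ℝ}

lemma normalDeriv_mul_eq (T : Triangulation Ω) (u w : Euc d → ℝ) (x : Euc d) :
    normalDeriv T u x * bdryTrace T w x = ∑ k, outerNormal Ω x k *
      (bdryTrace T (weakPartial Ω k u) x * bdryTrace T w x) := by
  rw [normalDeriv, Finset.sum_mul]
  exact Finset.sum_congr rfl fun k _ => by ring

lemma integrableOn_normalDeriv_mul [NeZero d] (hΩ : IsPolyhedralDomain Ω) (T : Triangulation Ω)
    (hu : MemH2 Ω u) (hw : MemH1 Ω w) :
    IntegrableOn (fun x => normalDeriv T u x * bdryTrace T w x) (frontier Ω) (surf d) := by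
  simp_rw [normalDeriv_mul_eq]
  exact integrable_finsetSum _ fun k _ => integrableOn_bdry hΩ T (hu.2 k) hw k

/-- Green's formula for `u ∈ H²(Ω)` and `w ∈ H¹(Ω)`. -/
lemma green_formula [NeZero d] (hΩ : IsPolyhedralDomain Ω) (T : Triangulation Ω)
    (hu : MemH2 Ω u) (hw : MemH1 Ω w) :
    innerGrad Ω u w + innerL2 Ω (laplacian Ω u) w =
      ∫ x in frontier Ω, normalDeriv T u x * bdryTrace T w x ∂(surf d) := by
  simp_rw [normalDeriv_mul_eq]
  rw [integral_finsetSum _ fun k _ => integrableOn_bdry hΩ T (hu.2 k) hw k, innerGrad, innerL2]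
  simp_rw [laplacian, Finset.sum_mul]
  have i1 : ∀ k, IntegrableOn (fun x => weakPartial Ω k u x * weakPartial Ω k w x) Ω := fun k =>
    (hu.1.memL2_weakPartial k).integrable_mul (hw.memL2_weakPartial k)
  have i2 : ∀ k, IntegrableOn (fun x => weakPartial Ω k (weakPartial Ω k u) x * w x) Ω := fun k =>
    ((hu.2 k).memL2_weakPartial k).integrable_mul hw.1
  rw [integral_finsetSum _ fun k _ => i1 k, integral_finsetSum _ fun k _ => i2 k,
    ← Finset.sum_add_distrib]
  refine Finset.sum_congr rfl fun k _ => ?_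
  rw [← integral_by_parts hΩ T (hu.2 k) hw k]
  congr 1
  exact integral_congr_ae (Eventually.of_forall fun x => mul_comm _ _)

end Global

/-! ### Consistency -/

section Consistency

variable {Ω ΓV ΓW : Set (Euc d)} {κ : ℝ} {f u w η : Euc d → ℝ}

lemma IsBoundarySplitting.symm (h : IsBoundarySplitting Ω ΓV ΓW) : IsBoundarySplitting Ω ΓW ΓV :=
  ⟨h.subset_W, h.subset_V, h.connected_W, h.connected_V, h.disjoint.symm,
    by rw [union_comm]; exact h.cover, h.null_W, h.null_V⟩

/-- A point of `closure ΓV` outside `ΓV` belongs to the relative boundary of `ΓV`, which is null. -/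
lemma IsBoundarySplitting.ae_mem_of_mem_closure (h : IsBoundarySplitting Ω ΓV ΓW) :
    ∀ᵐ x ∂(surf d), x ∈ closure ΓV → x ∈ ΓV := by
  filter_upwards [measure_eq_zero_iff_ae_notMem.1 h.null_V] with x hx hxc
  by_contra hxV
  exact hx ⟨hxc, subset_closure ⟨closure_minimal h.subset_V isClosed_frontier hxc, hxV⟩⟩

/-- No measurability of `ΓV` is assumed; it differs from its closure by a null set. -/
lemma IsBoundarySplitting.nullMeasurableSet (h : IsBoundarySplitting Ω ΓV ΓW) :
    NullMeasurableSet ΓV (surf d) := by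
  refine (isClosed_closure (s := ΓV)).measurableSet.nullMeasurableSet.congr ?_
  filter_upwards [h.ae_mem_of_mem_closure] with x hx
  exact propext ⟨hx, fun h' => subset_closure h'⟩

lemma IsBoundarySplitting.ae_mem_or (h : IsBoundarySplitting Ω ΓV ΓW) :
    ∀ᵐ x ∂(surf d), x ∈ frontier Ω → x ∉ ΓW → x ∈ ΓV := by
  filter_upwards [h.ae_mem_of_mem_closure, h.symm.ae_mem_of_mem_closure] with x hV hW hx hxW
  rw [← h.cover] at hx
  exact hx.elim hV fun h' => absurd (hW h') hxW

lemma IsBoundarySplitting.ae_notMem_closure (h : IsBoundarySplitting Ω ΓV ΓW) :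
    ∀ᵐ x ∂(surf d), x ∈ ΓV → x ∉ closure ΓW := by
  filter_upwards [h.symm.ae_mem_of_mem_closure] with x hW hx hxc
  exact Set.disjoint_left.1 h.disjoint hx (hW hxc)

lemma memL2_laplacian (hu : MemH2 Ω u) : MemL2 Ω (laplacian Ω u) :=
  memLp_finsetSum _ fun k _ => (hu.2 k).memL2_weakPartial k

lemma memL2_opL (hu : MemH2 Ω u) : MemL2 Ω (opL Ω κ u) :=
  (memL2_laplacian hu).neg.add (hu.1.1.const_mul κ)

lemma innerL2_opL (hu : MemH2 Ω u) (hw : MemL2 Ω w) :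
    innerL2 Ω (opL Ω κ u) w = - innerL2 Ω (laplacian Ω u) w + κ * innerL2 Ω u w := by
  have i1 : IntegrableOn (fun x => laplacian Ω u x * w x) Ω :=
    (memL2_laplacian hu).integrable_mul hw
  have i2 : IntegrableOn (fun x => u x * w x) Ω := hu.1.1.integrable_mul hw
  have i3 : Integrable (fun x => -(laplacian Ω u x * w x)) (volume.restrict Ω) := i1.neg
  have i4 : Integrable (fun x => κ * (u x * w x)) (volume.restrict Ω) := i2.const_mul κ
  rw [innerL2, innerL2, innerL2, ← integral_neg, ← integral_const_mul, ← integral_add i3 i4]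
  refine integral_congr_ae (Eventually.of_forall fun x => ?_)
  simp only [opL]
  ring

lemma formA_eq [NeZero d] (hΩ : IsPolyhedralDomain Ω) (T : Triangulation Ω) (hu : MemH2 Ω u)
    (hw : MemH1 Ω w) : formA Ω κ u w = innerL2 Ω (opL Ω κ u) w +
      ∫ x in frontier Ω, normalDeriv T u x * bdryTrace T w x ∂(surf d) := by
  rw [← green_formula hΩ T hu hw, innerL2_opL hu hw.1, formA]
  ring

lemma surf_frontier_lt_top [NeZero d] (hΩ : IsPolyhedralDomain Ω) (T : Triangulation Ω) :
    surf d (frontier Ω) < ⊤ := by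
  refine (measure_mono (frontier_subset_skeleton hΩ T)).trans_lt ?_
  rw [← Measure.restrict_apply_univ]
  exact measure_lt_top _ _

lemma hasTrace_frontier_of_contDiff [NeZero d] (hΩ : IsPolyhedralDomain Ω) (T : Triangulation Ω)
    (hη : ContDiff ℝ ∞ η) : HasTrace Ω (frontier Ω) η η := by
  have hb := isBounded_domain T
  exact hasTrace_of_contDiff hΩ.2.1 hb hη (memLp_surf_of_continuous
    (hb.closure.subset frontier_subset_closure) (surf_frontier_lt_top hΩ T) hη.continuous)

lemma bdryTrace_of_contDiff [NeZero d] (hΩ : IsPolyhedralDomain Ω) (T : Triangulation Ω)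
    (hη : ContDiff ℝ ∞ η) : bdryTrace T η =ᵐ[(surf d).restrict (frontier Ω)] η :=
  (hasTrace_frontier_of_contDiff hΩ T hη).bdryTrace_ae_eq hΩ T

lemma integrableOn_normalDeriv [NeZero d] (hΩ : IsPolyhedralDomain Ω) (T : Triangulation Ω)
    (hu : MemH2 Ω u) : IntegrableOn (normalDeriv T u) (frontier Ω) (surf d) := by
  -- Pairing with the constant function `1` reduces integrability of `∇u·n` to that of a product of
  -- traces.
  have h1 : ContDiff ℝ ∞ fun _ : Euc d => (1 : ℝ) := contDiff_const
  refine Integrable.congr (integrableOn_normalDeriv_mul hΩ T hu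
    (memH1_of_contDiff (isBounded_domain T) h1)) ?_
  filter_upwards [bdryTrace_of_contDiff hΩ T h1] with x hx
  rw [hx, mul_one]

lemma ae_eq_zero_of_memH1Zero [NeZero d] (hΩ : IsPolyhedralDomain Ω) (T : Triangulation Ω)
    (hΓ : ΓV ⊆ frontier Ω) (hu : MemH1Zero Ω ΓV u) :
    ∀ᵐ x ∂((surf d).restrict ΓV), bdryTrace T u x = 0 := by
  obtain ⟨-, g, hg, hg0⟩ := hu
  filter_upwards [ae_restrict_of_ae_restrict_of_subset hΓ (hg.bdryTrace_ae_eq hΩ T), hg0]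
    with x h1 h2
  rw [h1, h2]

/-- A function of `H²(Ω)` with vanishing Cauchy data on `Γ_V` satisfies the consistency relation. -/
lemma formAh_eq [NeZero d] (hΩ : IsPolyhedralDomain Ω) (hΓ : IsBoundarySplitting Ω ΓV ΓW)
    (T : Triangulation Ω) (hu : MemH2 Ω u) (hu0 : MemH1Zero Ω ΓV u)
    (hn : ∀ᵐ x ∂((surf d).restrict ΓV), normalDeriv T u x = 0) (hw : MemH1 Ω w) :
    formAh T ΓV ΓW κ u w = innerL2 Ω (opL Ω κ u) w := by
  -- The factor `u` vanishes here, so the value of `normalDeriv T w` is irrelevant, including the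
  -- default used when a component of `∇w` has no trace.
  have h1 : ∫ x in ΓV, normalDeriv T w x * bdryTrace T u x ∂(surf d) = 0 := by
    refine integral_eq_zero_of_ae ?_
    filter_upwards [ae_eq_zero_of_memH1Zero hΩ T hΓ.subset_V hu0] with x hx
    rw [hx, mul_zero, Pi.zero_apply]
  have h2 : ∫ x in frontier Ω, normalDeriv T u x * bdryTrace T w x ∂(surf d) =
      ∫ x in ΓW, normalDeriv T u x * bdryTrace T w x ∂(surf d) := by
    refine setIntegral_eq_of_subset_of_ae_sdiff_eq_zero
      isClosed_frontier.measurableSet.nullMeasurableSet hΓ.subset_W ?_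
    filter_upwards [hΓ.ae_mem_or, (ae_restrict_iff'₀ hΓ.nullMeasurableSet).1 hn] with x hx h0 hxd
    rw [h0 (hx hxd.1 hxd.2), zero_mul]
  have h3 := formA_eq (κ := κ) hΩ T hu hw
  rw [formA, h2] at h3
  rw [formAh, h1]
  linarith

/-- Weak solutions in `H²(Ω)` satisfy the natural boundary condition. -/
lemma IsWeakPrimal.normalDeriv_eq_zero [NeZero d] (hΩ : IsPolyhedralDomain Ω)
    (hΓ : IsBoundarySplitting Ω ΓV ΓW) (T : Triangulation Ω) (hf : MemL2 Ω f) (hu : MemH2 Ω u)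
    (h : IsWeakPrimal Ω ΓV ΓW κ f u) :
    ∀ᵐ x ∂((surf d).restrict ΓV), normalDeriv T u x = 0 := by
  have hb := isBounded_domain T
  -- Smooth functions vanishing on `ΓW` belong to `W`, so the weak equation combined with Green's
  -- formula applies to them.
  have key : ∀ η : Euc d → ℝ, ContDiff ℝ ∞ η → (∀ x ∈ ΓW, η x = 0) →
      innerL2 Ω f η = innerL2 Ω (opL Ω κ u) η +
        ∫ x in frontier Ω, normalDeriv T u x * η x ∂(surf d) := by
    intro η hη h0
    have hη1 := memH1_of_contDiff hb hη
    have hz : MemH1Zero Ω ΓW η := ⟨hη1, η, hasTrace_frontier_of_contDiff hΩ T hη,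
      (ae_restrict_iff'₀ hΓ.symm.nullMeasurableSet).2 (Eventually.of_forall h0)⟩
    rw [← h.2 η hz, formA_eq hΩ T hu hη1]
    congr 1
    refine integral_congr_ae ?_
    filter_upwards [bdryTrace_of_contDiff hΩ T hη] with x hx
    rw [hx]
  -- Test functions with compact support in `Ω` see no boundary term and give the equation in `Ω`.
  have hop : opL Ω κ u =ᵐ[volume.restrict Ω] f := by
    have hsub : MemLp (opL Ω κ u - f) 2 (volume.restrict Ω) := (memL2_opL hu).sub hf
    have hz := hΩ.2.1.ae_eq_zero_of_integral_contDiff_smul_eq_zero (μ := volume)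
      (f := opL Ω κ u - f) (locallyIntegrableOn_of_locallyIntegrable_restrict
        (hsub.locallyIntegrable (by norm_num))) fun η h1 h2 h3 => ?_
    · rw [Filter.EventuallyEq, ae_restrict_iff' hΩ.2.1.measurableSet]
      filter_upwards [hz] with x hx hxΩ
      exact sub_eq_zero.1 (hx hxΩ)
    · have hη0 : ∀ x ∈ frontier Ω, η x = 0 := fun x hx =>
        image_eq_zero_of_notMem_tsupport fun hx' => by
          rw [frontier_eq hΩ] at hx
          exact hx.2 (h3 hx')
      have hk := key η h1 fun x hx => hη0 x (hΓ.subset_W hx)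
      rw [setIntegral_eq_zero_of_forall_eq_zero fun x hx => by rw [hη0 x hx, mul_zero],
        add_zero] at hk
      have e : ∫ x, η x • (opL Ω κ u - f) x = ∫ x in Ω, η x • (opL Ω κ u - f) x := by
        refine (setIntegral_eq_integral_of_forall_compl_eq_zero fun x hx => ?_).symm
        rw [image_eq_zero_of_notMem_tsupport fun hx' => hx (h3 hx'), zero_smul]
      have hm := memLp_test (D := Ω) (μ := volume) h1.continuous h2
      have i1 : IntegrableOn (fun x => opL Ω κ u x * η x) Ω := (memL2_opL hu).integrable_mul hm
      have i2 : IntegrableOn (fun x => f x * η x) Ω := hf.integrable_mul hm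
      have e2 : ∀ x, η x • (opL Ω κ u - f) x = opL Ω κ u x * η x - f x * η x := fun x => by
        simp only [smul_eq_mul, Pi.sub_apply]; ring
      simp_rw [e, e2]
      rw [integral_sub i1 i2]
      exact sub_eq_zero.2 hk.symm
  -- With the equation known, test functions supported off `closure ΓW` leave only the boundary
  -- term. The fundamental lemma, for surface measure on the frontier, then gives a vanishing normal
  -- derivative off `closure ΓW`, which includes almost all of `ΓV`.
  have hbd := (isClosed_closure (s := ΓW)).isOpen_compl.ae_eq_zero_of_integral_contDiff_smul_eq_zero
    (μ := (surf d).restrict (frontier Ω)) (f := normalDeriv T u)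
    ((integrableOn_normalDeriv hΩ T hu).locallyIntegrable.locallyIntegrableOn _) fun η h1 h2 h3 => ?_
  · have h4 := (ae_restrict_iff' isClosed_frontier.measurableSet).1 hbd
    rw [ae_restrict_iff'₀ hΓ.nullMeasurableSet]
    filter_upwards [h4, hΓ.ae_notMem_closure] with x hx hxc hxV
    exact hx (hΓ.subset_V hxV) (hxc hxV)
  · have hk := key η h1 fun x hx =>
      image_eq_zero_of_notMem_tsupport fun hx' => h3 hx' (subset_closure hx)
    have e : innerL2 Ω (opL Ω κ u) η = innerL2 Ω f η :=
      integral_congr_ae (hop.mul (ae_eq_refl η))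
    rw [e, left_eq_add] at hk
    simpa only [smul_eq_mul, mul_comm] using hk

/-- Primal consistency, with test functions from `H¹(Ω)`. -/
lemma primal_consistency [NeZero d] (hΩ : IsPolyhedralDomain Ω) (hΓ : IsBoundarySplitting Ω ΓV ΓW)
    (T : Triangulation Ω) (hf : MemL2 Ω f) (hu : MemH2 Ω u)
    (h : IsWeakPrimal Ω ΓV ΓW κ f u ∨ IsStrongPrimal T ΓV κ f u) (hw : MemH1 Ω w) :
    formAh T ΓV ΓW κ u w = innerL2 Ω (opL Ω κ u) w := by
  rcases h with h | h
  · exact formAh_eq hΩ hΓ T hu h.1 (h.normalDeriv_eq_zero hΩ hΓ T hf hu) hw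
  · exact formAh_eq hΩ hΓ T hu h.1 h.2.2 hw

lemma innerL2_comm (v w : Euc d → ℝ) : innerL2 Ω v w = innerL2 Ω w v := by
  simp only [innerL2, mul_comm]

lemma innerGrad_comm (v w : Euc d → ℝ) : innerGrad Ω v w = innerGrad Ω w v := by
  simp only [innerGrad, mul_comm]

/-- Exchanging the arguments together with the boundary parts permutes the two boundary terms; this
reduces the adjoint statement to the primal one. -/
lemma formAh_comm (T : Triangulation Ω) (v w : Euc d → ℝ) :
    formAh T ΓV ΓW κ v w = formAh T ΓW ΓV κ w v := by
  rw [formAh, formAh, innerGrad_comm, innerL2_comm]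
  ring

lemma IsWeakAdjoint.isWeakPrimal (h : IsWeakAdjoint Ω ΓV ΓW κ f u) :
    IsWeakPrimal Ω ΓW ΓV κ f u :=
  ⟨h.1, fun w hw => by rw [← h.2 w hw, formA, formA, innerGrad_comm, innerL2_comm]⟩

end Consistency
end CauchyFEM

end

theorem mainTheorem8 {d : ℕ} (hd : d = 2 ∨ d = 3)
    (Ω : Set (CauchyFEM.Euc d)) (hΩ : CauchyFEM.IsPolyhedralDomain Ω)
    (ΓV ΓW : Set (CauchyFEM.Euc d)) (hΓ : CauchyFEM.IsBoundarySplitting Ω ΓV ΓW)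
    (T : CauchyFEM.Triangulation Ω) (k : ℕ) (κ : ℝ) :
    -- consistency for the primal problem, with test functions `w + wh ∈ W + W_h`
    (∀ f u : CauchyFEM.Euc d → ℝ, CauchyFEM.MemL2 Ω f → CauchyFEM.MemH2 Ω u →
      (CauchyFEM.IsWeakPrimal Ω ΓV ΓW κ f u ∨ CauchyFEM.IsStrongPrimal T ΓV κ f u) →
      ∀ w wh : CauchyFEM.Euc d → ℝ, CauchyFEM.MemH1Zero Ω ΓW w → CauchyFEM.MemFE T k wh →
        CauchyFEM.formAh T ΓV ΓW κ u (w + wh) =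
          CauchyFEM.innerL2 Ω (CauchyFEM.opL Ω κ u) (w + wh)) ∧
    -- consistency for the adjoint problem, with test functions `v + vh ∈ V + V_h`
    (∀ g z : CauchyFEM.Euc d → ℝ, CauchyFEM.MemL2 Ω g → CauchyFEM.MemH2 Ω z →
      (CauchyFEM.IsWeakAdjoint Ω ΓV ΓW κ g z ∨ CauchyFEM.IsStrongAdjoint T ΓW κ g z) →
      ∀ v vh : CauchyFEM.Euc d → ℝ, CauchyFEM.MemH1Zero Ω ΓV v → CauchyFEM.MemFE T k vh →
        CauchyFEM.formAh T ΓV ΓW κ (v + vh) z =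
          CauchyFEM.innerL2 Ω (v + vh) (CauchyFEM.opLAdj Ω κ z)) := by
  have : NeZero d := ⟨by omega⟩
  refine ⟨fun f u hf hu h w wh hw hwh => ?_, fun g z hg hz h v vh hv hvh => ?_⟩
  · exact CauchyFEM.primal_consistency hΩ hΓ T hf hu h (hw.1.add hwh.1)
  -- The adjoint problem is the primal problem with `ΓV` and `ΓW` exchanged. The operators and the
  -- strong formulations then coincide by definition, and only the weak formulation needs the
  -- symmetry of `a`.
  · rw [CauchyFEM.formAh_comm, CauchyFEM.innerL2_comm]
    exact CauchyFEM.primal_consistency hΩ hΓ.symm T hg hz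
      (h.imp (fun h' => h'.isWeakPrimal) id) (hv.1.add hvh.1)
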